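/- For a probability distribution $\pi$ on $\mathbb{R}$ with zero mean, unit variance and finite entropy $H(\pi)$ (so $\pi$ is discrete and $H(\pi)=-\sum_x \pi(\{x\})\log\pi(\{x\})<\infty$, with natural logarithms), let $\beta_0\sim\pi$ and $N\sim\mathcal{N}(0,1)$ be independent, and for $s\ge 0$ put $$I(s)=I(\beta_0;\sqrt{s}\,\beta_0+N),\qquad M(s)=\mathbb{E}\big[(\beta_0-\mathbb{E}[\beta_0\mid\sqrt{s}\,\beta_0+N])^2\big],$$ where $I(\cdot\,;\cdot)$ is mutual information in nats. For $\delta,\mathrm{snr}>0$, the replica-symmetric (RS) potential is $$\mathcal{F}(s)=I(s)+\frac{\delta}{2}\,\phi\Big(\frac{s}{\delta\,\mathrm{snr}}\Big),\quad s>0,\qquad \phi(x)=x-\log x-1,$$ and $s^{\mathrm{AMP}}=\inf\{s>0:\mathcal{F}'(s)=0\}$. **Theorem 2.** Let $(\pi_\epsilon)_{\epsilon>0}$ be a family of probability distributions on $\mathbb{R}$ with zero mean, unit variance and finite entropies $H_\epsilon=H(\pi_\epsilon)$, whose functions $M_\epsilon$ satisfy, as $\epsilon\to0^+$, $M_\epsilon(2H_\epsilon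 t)\to1$ for every $t\in[0,1)$ and $M_\epsilon(2H_\epsilon t)\to0$ for every $t\in(1,\infty)$. Let $r\in(0,1)\cup(1,\infty)$ and let $\delta_\epsilon,\mathrm{snr}_\epsilon\in(0,\infty)$ for $\epsilon>0$ be such that $$\lim_{\epsilon\to0^+}\frac{\delta_\epsilon}{\delta_{\epsilon,\mathrm{AMP}}}=r,\qquad \delta_{\epsilon,\mathrm{AMP}}=\frac{2H_\epsilon(1+\mathrm{snr}_\epsilon)}{\mathrm{snr}_\epsilon}.$$ Let $s^{\mathrm{AMP}}_\epsilon$ be the number $s^{\mathrm{AMP}}$ of the triplet $(\delta_\epsilon,\mathrm{snr}_\epsilon,\pi_\epsilon)$. Then for every $\epsilon>0$ the infimum defining $s^{\mathrm{AMP}}_\epsilon$ is attained, so that $s^{\mathrm{AMP}}_\epsilon$ is the smallest stationary point of the RS potential on $(0,\infty)$, and $$r\in(0,1)\implies\lim_{\epsilon\to0^+}M_\epsilon(s^{\mathrm{AMP}}_\epsilon)=1,\qquad r\in(1,\infty)\implies\lim_{\epsilon\to0^+}M_\epsilon(s^{\mathrm{AMP}}_\epsilon)=0.$$ -/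

import Mathlib

open MeasureTheory ProbabilityTheory Filter Topology
open scoped ENNReal

noncomputable section

namespace SingleLetter

/-- Shannon entropy (natural logarithm) of a probability distribution on the real line: the sum of
`-p log p` over the atoms if the distribution is discrete (carried by a countable set), and `∞`
otherwise. In particular, a distribution of finite entropy is discrete. -/
def entropy (π : Measure ℝ) : ℝ≥0∞ :=
  open Classical in
  if ∃ S : Set ℝ, S.Countable ∧ π Sᶜ = 0 then
    ∑' x : ℝ, ENNReal.ofReal (Real.negMulLog (π.real {x}))
  else ∞

/-- The entropy as a real number, meaningful when the entropy is finite. -/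
def H (π : Measure ℝ) : ℝ := (entropy π).toReal

/-- `π` is a probability distribution with zero mean and unit variance. -/
structure IsStandardized (π : Measure ℝ) : Prop where
  isProbabilityMeasure : IsProbabilityMeasure π
  memLp_two : MemLp (fun x : ℝ => x) 2 π
  mean_eq_zero : ∫ x, x ∂π = 0
  variance_eq_one : Var[fun x : ℝ => x; π] = 1

/-- The law of `(β₀, N)`: independent coordinates, `β₀ ∼ π` and `N ∼ 𝒩(0, 1)`. -/
def inputNoise (π : Measure ℝ) : Measure (ℝ × ℝ) := π.prod (gaussianReal 0 1)

/-- The output `√s β₀ + N` of the single letter channel, as a function of `(β₀, N)`. -/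
def output (s : ℝ) (ω : ℝ × ℝ) : ℝ := √s * ω.1 + ω.2

/-- The mutual information `I(β₀; √s β₀ + N)` in nats: the Kullback–Leibler divergence of the joint
law of input and output from the product of their marginal laws. -/
def mutualInfo (π : Measure ℝ) (s : ℝ) : ℝ :=
  (InformationTheory.klDiv
    ((inputNoise π).map (fun ω => (ω.1, output s ω)))
    (π.prod ((inputNoise π).map (output s)))).toReal

/-- The minimum mean squared error `mmse(β₀ | √s β₀ + N) = 𝔼[(β₀ - 𝔼[β₀ | √s β₀ + N])²]`. -/
def mmse (π : Measure ℝ) (s : ℝ) : ℝ :=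
  ∫ ω, (ω.1 -
    ((inputNoise π)[fun ω : ℝ × ℝ => ω.1 | MeasurableSpace.comap (output s) inferInstance]) ω) ^ 2
    ∂(inputNoise π)

/-- `φ(x) = x - log x - 1`, used for `x > 0`. -/
def phi (x : ℝ) : ℝ := x - Real.log x - 1

/-- The replica-symmetric potential `ℱ(s) = I(s) + (δ/2) φ(s / (δ snr))`, used for `s > 0`. -/
def potential (δ snr : ℝ) (π : Measure ℝ) (s : ℝ) : ℝ :=
  mutualInfo π s + δ / 2 * phi (s / (δ * snr))

/-- The stationary points of the potential on `(0, ∞)`. -/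
def stationaryPoints (δ snr : ℝ) (π : Measure ℝ) : Set ℝ :=
  {s | 0 < s ∧ HasDerivAt (potential δ snr π) 0 s}

/-- The smallest stationary point of the potential. -/
def sAMP (δ snr : ℝ) (π : Measure ℝ) : ℝ := sInf (stationaryPoints δ snr π)

/-- The threshold `2 H (1 + snr) / snr`. -/
def deltaAMP (snr : ℝ) (π : Measure ℝ) : ℝ := 2 * H π * (1 + snr) / snr

/-- The distributions `π ε`, `ε > 0`, are standardized with finite entropy, and their single letter
MMSE functions, with argument rescaled by twice the entropy, converge pointwise (except at `1`) to
the unit step function as `ε → 0⁺`. -/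
structure StepAssumption (π : ℝ → Measure ℝ) : Prop where
  standardized : ∀ ε, 0 < ε → IsStandardized (π ε)
  entropy_ne_top : ∀ ε, 0 < ε → entropy (π ε) ≠ ∞
  tendsto_one : ∀ t ∈ Set.Ico (0 : ℝ) 1,
    Tendsto (fun ε => mmse (π ε) (2 * H (π ε) * t)) (𝓝[>] 0) (𝓝 1)
  tendsto_zero : ∀ t ∈ Set.Ioi (1 : ℝ),
    Tendsto (fun ε => mmse (π ε) (2 * H (π ε) * t)) (𝓝[>] 0) (𝓝 0)

end SingleLetter

end

namespace SingleLetter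

/-! By the I-MMSE relation `I' = M / 2`, the equation `ℱ'(s) = 0` for `s > 0` reads `g(s) = δ` with
`g(s) = s (M(s) + 1/snr)`. Since `g` is continuous, `g(0) = 0` and `g(δ snr) ≥ δ`, solutions exist
and form a closed set, so a least one exists (`isLeast_sAMP`).

Write `ρ = δ / δ_AMP`, so that `δ = 2Hρ (1 + 1/snr)`. From `M ≤ 1` every solution is at least `2Hρ`
(`le_sAMP_of_le_ratio`). Conversely, if `ρ ≤ t M(2Ht)` then `g(2Ht) ≥ δ`, so the least solution is
at most `2Ht` (`sAMP_le_of_ratio_le`). For `r < 1` take `t` in `(r, 1)`: `t M(2Ht) → t > r`, hence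
`M(sAMP) ≥ M(2Ht) → 1`. For `r > 1` take `t` in `(1, r)`: `M(sAMP) ≤ M(2Ht) → 0`. Both steps use
that `M` is nonincreasing.

Most of the work is to establish the properties of `M` and `I`. With `𝒩(0, 1)` as reference measure,
`mmse_eq` and `mutualInfo_eq_sub_outputDivergence` express them through `posteriorMeanSq` and
`outputDivergence`. The derivative of the latter comes from Stein's identity for bounded inputs and
from truncation in general; monotonicity comes from the Ornstein–Uhlenbeck semigroup. -/

/-- Cauchy–Schwarz in the form `(∫ u)² ≤ ∫ v * ∫ w` for `u² ≤ v w`. -/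
lemma sq_integral_le_integral_mul_integral {α : Type*} [MeasurableSpace α] {μ : Measure α}
    {u v w : α → ℝ} (hu : Integrable u μ) (hv : Integrable v μ) (hw : Integrable w μ)
    (hv0 : ∀ x, 0 ≤ v x) (hw0 : ∀ x, 0 ≤ w x) (h : ∀ x, u x ^ 2 ≤ v x * w x) :
    (∫ x, u x ∂μ) ^ 2 ≤ (∫ x, v x ∂μ) * ∫ x, w x ∂μ := by
  -- The quadratic `v t² + 2ut + w` is nonnegative pointwise, hence so is its integral, whose
  -- discriminant gives the claim.
  have key : ∀ t : ℝ, 0 ≤ (∫ x, v x ∂μ) * (t * t) + (2 * ∫ x, u x ∂μ) * t + ∫ x, w x ∂μ := by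
    intro t
    have e : (∫ x, v x ∂μ) * (t * t) + (2 * ∫ x, u x ∂μ) * t + ∫ x, w x ∂μ
        = ∫ x, (v x * (t * t) + (2 * u x) * t + w x) ∂μ := by
      rw [integral_add (by fun_prop) hw, integral_add (by fun_prop) (by fun_prop),
        integral_mul_const, integral_mul_const, integral_const_mul]
    rw [e]
    refine integral_nonneg fun x => ?_
    change 0 ≤ v x * (t * t) + (2 * u x) * t + w x
    rcases (hv0 x).eq_or_lt with h0 | h0
    · have hu0 : u x = 0 := by
        have := h x
        rw [← h0, zero_mul] at this
        exact pow_eq_zero_iff two_ne_zero |>.1 (le_antisymm this (sq_nonneg _))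
      simp [← h0, hu0, hw0 x]
    · have h1 : 0 ≤ v x * (v x * (t * t) + (2 * u x) * t + w x) := by
        nlinarith [h x, sq_nonneg (v x * t + u x)]
      exact nonneg_of_mul_nonneg_right h1 h0
  have := discrim_le_zero key
  rw [discrim] at this
  nlinarith

/-! ### The Gaussian channel as a change of measure -/

/-- The density at `y` of `𝒩(τ x, 1)` with respect to `𝒩(0, 1)`. -/
noncomputable def tilt (τ x y : ℝ) : ℝ := Real.exp (τ * x * y - (τ * x) ^ 2 / 2)

lemma tilt_pos (τ x y : ℝ) : 0 < tilt τ x y := Real.exp_pos _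

/-- Completing the square. The bound is uniform in `τ` and `x`, so `x ^ k * tilt τ x y` is
integrable as soon as `x ^ k` is. -/
lemma tilt_le (τ x y : ℝ) : tilt τ x y ≤ Real.exp (y ^ 2 / 2) :=
  Real.exp_le_exp.2 (by nlinarith [sq_nonneg (y - τ * x)])

@[fun_prop]
lemma Continuous.tilt {X : Type*} [TopologicalSpace X] {f g h : X → ℝ} (hf : Continuous f)
    (hg : Continuous g) (hh : Continuous h) : Continuous fun z => tilt (f z) (g z) (h z) := by
  unfold SingleLetter.tilt; fun_prop

@[fun_prop]
lemma Measurable.tilt {X : Type*} [MeasurableSpace X] {f g h : X → ℝ} (hf : Measurable f)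
    (hg : Measurable g) (hh : Measurable h) : Measurable fun z => tilt (f z) (g z) (h z) := by
  unfold SingleLetter.tilt; fun_prop

lemma map_const_add_gaussianReal (a : ℝ) :
    (gaussianReal 0 1).map (a + ·)
      = (gaussianReal 0 1).withDensity fun y => ENNReal.ofReal (tilt 1 a y) := by
  rw [gaussianReal_map_const_add, gaussianReal_of_var_ne_zero _ one_ne_zero,
    gaussianReal_of_var_ne_zero _ one_ne_zero, ← withDensity_mul _ (by fun_prop) (by fun_prop)]
  congr 1
  ext y
  simp only [gaussianPDF, Pi.mul_apply, zero_add]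
  rw [← ENNReal.ofReal_mul (gaussianPDFReal_nonneg _ _ _)]
  congr 1
  simp only [gaussianPDFReal, tilt, mul_assoc]
  rw [← Real.exp_add]
  congr 2
  simp
  ring

/-- For each fixed input this is the shift formula for the Gaussian. It moves the dependence on `τ`
from the measure into the density. -/
lemma map_channel_prod (μ : Measure ℝ) [SFinite μ] (τ : ℝ) :
    (μ.prod (gaussianReal 0 1)).map (fun ω => (ω.1, τ * ω.1 + ω.2))
      = (μ.prod (gaussianReal 0 1)).withDensity
          fun ω => ENNReal.ofReal (tilt τ ω.1 ω.2) := by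
  refine Measure.ext_of_lintegral _ fun f hf => ?_
  rw [lintegral_map hf (by fun_prop), lintegral_withDensity_eq_lintegral_mul _ (by fun_prop) hf,
    lintegral_prod _ (by fun_prop), lintegral_prod _ (by fun_prop)]
  refine lintegral_congr fun x => ?_
  have h1 := lintegral_map (μ := gaussianReal 0 1) (f := fun y => f (x, y)) (g := (τ * x + ·))
    (by fun_prop) (by fun_prop)
  rw [map_const_add_gaussianReal,
    lintegral_withDensity_eq_lintegral_mul _ (by fun_prop) (by fun_prop)] at h1
  rw [← h1]
  simp [tilt, Pi.mul_apply]

lemma integrable_channel_iff (μ : Measure ℝ) [SFinite μ] (τ : ℝ) {g : ℝ × ℝ → ℝ}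
    (hg : Measurable g) :
    Integrable (fun ω : ℝ × ℝ => g (ω.1, τ * ω.1 + ω.2)) (μ.prod (gaussianReal 0 1)) ↔
      Integrable (fun ω : ℝ × ℝ => tilt τ ω.1 ω.2 * g ω) (μ.prod (gaussianReal 0 1)) := by
  have h := integrable_map_measure (μ := μ.prod (gaussianReal 0 1))
    (f := fun ω : ℝ × ℝ => (ω.1, τ * ω.1 + ω.2)) hg.aestronglyMeasurable (by fun_prop)
  rw [map_channel_prod, integrable_withDensity_iff_integrable_smul' (by fun_prop) (by simp)] at h
  refine h.symm.trans (integrable_congr (ae_of_all _ fun ω => ?_))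
  simp [ENNReal.toReal_ofReal (tilt_pos _ _ _).le]

lemma integral_channel (μ : Measure ℝ) [SFinite μ] (τ : ℝ) {g : ℝ × ℝ → ℝ}
    (hg : Measurable g) :
    ∫ ω, g (ω.1, τ * ω.1 + ω.2) ∂(μ.prod (gaussianReal 0 1))
      = ∫ ω, tilt τ ω.1 ω.2 * g ω ∂(μ.prod (gaussianReal 0 1)) := by
  have h := integral_map (μ := μ.prod (gaussianReal 0 1))
    (φ := fun ω : ℝ × ℝ => (ω.1, τ * ω.1 + ω.2)) (by fun_prop) (hg.aestronglyMeasurable (μ := _))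
  rw [map_channel_prod, integral_withDensity_eq_integral_toReal_smul (by fun_prop) (by simp)] at h
  rw [← h]
  refine integral_congr_ae (ae_of_all _ fun ω => ?_)
  simp [ENNReal.toReal_ofReal (tilt_pos _ _ _).le]

/-! ### Unnormalized posterior moments -/

/-- The `k`-th moment of the unnormalized posterior given the output `y`. -/
noncomputable def tiltMoment (μ : Measure ℝ) (k : ℕ) (τ y : ℝ) : ℝ := ∫ x, x ^ k * tilt τ x y ∂μ

section

variable {μ : Measure ℝ}

lemma integrable_pow_mul_tilt {k : ℕ} (hk : Integrable (fun x : ℝ => x ^ k) μ) (τ y : ℝ) :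
    Integrable (fun x => x ^ k * tilt τ x y) μ := by
  refine hk.mul_bdd (c := Real.exp (y ^ 2 / 2)) (by fun_prop) (ae_of_all _ fun x => ?_)
  rw [Real.norm_eq_abs, abs_of_pos (tilt_pos _ _ _)]
  exact tilt_le _ _ _

lemma continuous_tiltMoment {k : ℕ} (hk : Integrable (fun x : ℝ => x ^ k) μ) :
    Continuous fun p : ℝ × ℝ => tiltMoment μ k p.1 p.2 := by
  refine continuous_iff_continuousAt.2 fun p => ?_
  unfold tiltMoment
  refine continuousAt_of_dominated (bound := fun x => |x ^ k| * Real.exp ((|p.2| + 1) ^ 2 / 2))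
    (Eventually.of_forall fun q => by fun_prop) ?_ (hk.abs.mul_const _)
    (ae_of_all _ fun x => by fun_prop)
  have : ∀ᶠ q : ℝ × ℝ in 𝓝 p, |q.2| < |p.2| + 1 :=
    (continuous_snd.abs.tendsto p).eventually (gt_mem_nhds (lt_add_one _))
  filter_upwards [this] with q hq
  refine ae_of_all _ fun x => ?_
  rw [Real.norm_eq_abs, abs_mul, abs_of_pos (tilt_pos _ _ _)]
  refine mul_le_mul_of_nonneg_left ((tilt_le _ _ _).trans (Real.exp_le_exp.2 ?_)) (abs_nonneg _)
  have : q.2 ^ 2 ≤ (|p.2| + 1) ^ 2 :=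
    sq_le_sq' (by linarith [neg_abs_le q.2]) (by linarith [le_abs_self q.2])
  linarith

lemma continuous_tiltMoment_right {k : ℕ} (hk : Integrable (fun x : ℝ => x ^ k) μ) (τ : ℝ) :
    Continuous (tiltMoment μ k τ) :=
  (continuous_tiltMoment hk).comp (by fun_prop : Continuous fun y : ℝ => (τ, y))

lemma continuous_tiltMoment_left {k : ℕ} (hk : Integrable (fun x : ℝ => x ^ k) μ) (y : ℝ) :
    Continuous fun τ => tiltMoment μ k τ y :=
  (continuous_tiltMoment hk).comp (by fun_prop : Continuous fun τ : ℝ => (τ, y))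

lemma integrable_pow_zero [IsFiniteMeasure μ] : Integrable (fun x : ℝ => x ^ 0) μ := by simp

lemma integrable_pow_one [IsFiniteMeasure μ] (h2 : Integrable (fun x : ℝ => x ^ 2) μ) :
    Integrable (fun x : ℝ => x ^ 1) μ := by
  refine (h2.add (integrable_const (1 : ℝ))).mono' (by fun_prop) (ae_of_all _ fun x => ?_)
  simp only [pow_one, Real.norm_eq_abs, Pi.add_apply]
  nlinarith [sq_nonneg (|x| - 1), sq_abs x, abs_nonneg x]

lemma tiltMoment_zero_pos [IsFiniteMeasure μ] [NeZero μ] (τ y : ℝ) : 0 < tiltMoment μ 0 τ y := by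
  unfold tiltMoment
  refine (integral_pos_iff_support_of_nonneg (fun x => ?_)
    (integrable_pow_mul_tilt integrable_pow_zero τ y)).2 ?_
  · simpa using (tilt_pos _ _ _).le
  · have : (Function.support fun x => x ^ 0 * tilt τ x y) = Set.univ := by
      ext x; simp [(tilt_pos _ _ _).ne']
    rw [this]
    exact NeZero.pos _

lemma tiltMoment_zero_nonneg (τ y : ℝ) : 0 ≤ tiltMoment μ 0 τ y :=
  integral_nonneg fun x => by simpa using (tilt_pos _ _ _).le

lemma tiltMoment_two_nonneg (τ y : ℝ) : 0 ≤ tiltMoment μ 2 τ y :=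
  integral_nonneg fun x => mul_nonneg (sq_nonneg x) (tilt_pos _ _ _).le

lemma tiltMoment_zero_le [IsProbabilityMeasure μ] (τ y : ℝ) :
    tiltMoment μ 0 τ y ≤ Real.exp (y ^ 2 / 2) := by
  have : tiltMoment μ 0 τ y ≤ ∫ _, Real.exp (y ^ 2 / 2) ∂μ :=
    integral_mono (integrable_pow_mul_tilt integrable_pow_zero τ y) (integrable_const _)
      fun x => by simpa using tilt_le τ x y
  simpa using this

lemma sq_tiltMoment_one_le [IsFiniteMeasure μ] (h2 : Integrable (fun x : ℝ => x ^ 2) μ)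
    (τ y : ℝ) : tiltMoment μ 1 τ y ^ 2 ≤ tiltMoment μ 2 τ y * tiltMoment μ 0 τ y := by
  refine sq_integral_le_integral_mul_integral (integrable_pow_mul_tilt (integrable_pow_one h2) τ y)
    (integrable_pow_mul_tilt h2 τ y) (integrable_pow_mul_tilt integrable_pow_zero τ y)
    (fun x => mul_nonneg (sq_nonneg x) (tilt_pos _ _ _).le)
    (fun x => by simpa using (tilt_pos _ _ _).le) fun x => le_of_eq (by ring)

/-- The pushforward formula against functions of the output. -/
lemma integrable_tiltMoment_mul_and_integral_eq [SFinite μ] {k : ℕ} {τ : ℝ} {h : ℝ → ℝ}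
    (hh : Measurable h)
    (hi : Integrable (fun ω : ℝ × ℝ => ω.1 ^ k * h (τ * ω.1 + ω.2)) (μ.prod (gaussianReal 0 1))) :
    Integrable (fun y => tiltMoment μ k τ y * h y) (gaussianReal 0 1) ∧
      ∫ y, tiltMoment μ k τ y * h y ∂(gaussianReal 0 1)
        = ∫ ω, ω.1 ^ k * h (τ * ω.1 + ω.2) ∂(μ.prod (gaussianReal 0 1)) := by
  have hg : Measurable fun ω : ℝ × ℝ => ω.1 ^ k * h ω.2 := by fun_prop
  have hi' := (integrable_channel_iff μ τ hg).1 hi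
  have e : ∀ y, ∫ x, tilt τ x y * (x ^ k * h y) ∂μ = tiltMoment μ k τ y * h y := fun y => by
    rw [tiltMoment, ← integral_mul_const]
    exact integral_congr_ae (ae_of_all _ fun x => by ring)
  refine ⟨by simpa only [e] using hi'.integral_prod_right, ?_⟩
  rw [integral_channel μ τ hg, integral_prod_symm _ hi']
  exact integral_congr_ae (ae_of_all _ fun y => (e y).symm)

lemma integrable_tiltMoment [IsFiniteMeasure μ] {k : ℕ} (hk : Integrable (fun x : ℝ => x ^ k) μ)
    (τ : ℝ) : Integrable (tiltMoment μ k τ) (gaussianReal 0 1) := by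
  have := (integrable_tiltMoment_mul_and_integral_eq (μ := μ) (k := k) (τ := τ) (h := fun _ => 1)
    (by fun_prop) (by simpa using hk.comp_fst _)).1
  simpa using this

lemma integral_tiltMoment [IsFiniteMeasure μ] {k : ℕ} (hk : Integrable (fun x : ℝ => x ^ k) μ)
    (τ : ℝ) : ∫ y, tiltMoment μ k τ y ∂(gaussianReal 0 1) = ∫ x, x ^ k ∂μ := by
  have := (integrable_tiltMoment_mul_and_integral_eq (μ := μ) (k := k) (τ := τ) (h := fun _ => 1)
    (by fun_prop) (by simpa using hk.comp_fst _)).2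
  simp only [mul_one] at this
  rw [this]
  exact (integral_fun_fst fun x : ℝ => x ^ k).trans (by simp)

end

/-! ### Continuity and monotonicity of the posterior mean square -/

/-- Pratt's form of the dominated convergence theorem, with a varying dominating function. -/
lemma tendsto_integral_of_le_of_tendsto_integral {α ι : Type*} [MeasurableSpace α] {ν : Measure α}
    {l : Filter ι} [l.IsCountablyGenerated] {f g : ι → α → ℝ} {f₀ g₀ : α → ℝ}
    (hfm : ∀ i, AEStronglyMeasurable (f i) ν)
    (hgi : ∀ i, Integrable (g i) ν) (hg₀ : Integrable g₀ ν)
    (hf0 : ∀ i x, 0 ≤ f i x) (hfg : ∀ i x, f i x ≤ g i x) (hg₀0 : ∀ x, 0 ≤ g₀ x)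
    (hfg₀ : ∀ x, f₀ x ≤ g₀ x)
    (hf : ∀ x, Tendsto (fun i => f i x) l (𝓝 (f₀ x)))
    (hg : ∀ x, Tendsto (fun i => g i x) l (𝓝 (g₀ x)))
    (hI : Tendsto (fun i => ∫ x, g i x ∂ν) l (𝓝 (∫ x, g₀ x ∂ν))) :
    Tendsto (fun i => ∫ x, f i x ∂ν) l (𝓝 (∫ x, f₀ x ∂ν)) := by
  have hfi : ∀ i, Integrable (f i) ν := fun i => (hgi i).mono' (hfm i)
    (ae_of_all _ fun x => by rw [Real.norm_eq_abs, abs_of_nonneg (hf0 i x)]; exact hfg i x)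
  -- Cutting off at `g₀` makes ordinary dominated convergence applicable.
  have key : ∀ (h : ι → α → ℝ) (h₀ : α → ℝ), (∀ i, Integrable (h i) ν) → (∀ i x, 0 ≤ h i x) →
      (∀ x, h₀ x ≤ g₀ x) → (∀ x, Tendsto (fun i => h i x) l (𝓝 (h₀ x))) →
      Tendsto (fun i => ∫ x, min (h i x) (g₀ x) ∂ν) l (𝓝 (∫ x, h₀ x ∂ν)) := by
    intro h h₀ hi h0 hle ht
    refine tendsto_integral_filter_of_dominated_convergence g₀
      (Eventually.of_forall fun i => ((hi i).inf hg₀).aestronglyMeasurable)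
      (Eventually.of_forall fun i => ae_of_all _ fun x => ?_) hg₀ (ae_of_all _ fun x => ?_)
    · rw [Real.norm_eq_abs, abs_of_nonneg (le_min (h0 i x) (hg₀0 x))]
      exact min_le_right _ _
    · simpa [min_eq_left (hle x)] using (ht x).min (tendsto_const_nhds (x := g₀ x))
  have h1 := key f f₀ hfi hf0 hfg₀ hf
  have h2 := key g g₀ hgi (fun i x => (hf0 i x).trans (hfg i x)) (fun _ => le_rfl) hg
  -- The part of `f` cut off above `g₀` is at most the part of `g` cut off, whose integral tends to
  -- `0`.
  refine tendsto_of_tendsto_of_tendsto_of_le_of_le (h := fun i => ∫ x, min (f i x) (g₀ x) ∂ν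
    + (∫ x, g i x ∂ν - ∫ x, min (g i x) (g₀ x) ∂ν)) h1 (by simpa using h1.add (hI.sub h2)) ?_ ?_
  · exact fun i => integral_mono ((hfi i).inf hg₀) (hfi i) fun x => min_le_left _ _
  · intro i
    have hm : Integrable (fun x => min (f i x) (g₀ x)) ν := (hfi i).inf hg₀
    have hm' : Integrable (fun x => min (g i x) (g₀ x)) ν := (hgi i).inf hg₀
    change _ ≤ (∫ x, min (f i x) (g₀ x) ∂ν) + (∫ x, g i x ∂ν - ∫ x, min (g i x) (g₀ x) ∂ν)
    have hs : Integrable (fun x => g i x - min (g i x) (g₀ x)) ν := (hgi i).sub hm'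
    rw [← integral_sub (hgi i) hm', ← integral_add hm hs]
    refine integral_mono (hfi i) (hm.add hs) fun x => ?_
    have := hfg i x
    change f i x ≤ min (f i x) (g₀ x) + (g i x - min (g i x) (g₀ x))
    rcases le_total (f i x) (g₀ x) with a | a <;> rcases le_total (g i x) (g₀ x) with b | b <;>
      simp only [min_eq_left, min_eq_right, a, b] <;> linarith

/-- The second moment of the posterior mean of the input given the output `τ β₀ + N`. -/
noncomputable def posteriorMeanSq (μ : Measure ℝ) (τ : ℝ) : ℝ :=
  ∫ y, tiltMoment μ 1 τ y ^ 2 / tiltMoment μ 0 τ y ∂(gaussianReal 0 1)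

section

variable {μ : Measure ℝ}

lemma sq_div_tiltMoment_nonneg (τ y : ℝ) :
    0 ≤ tiltMoment μ 1 τ y ^ 2 / tiltMoment μ 0 τ y :=
  div_nonneg (sq_nonneg _) (tiltMoment_zero_nonneg _ _)

lemma sq_div_tiltMoment_le [IsFiniteMeasure μ]
    (h2 : Integrable (fun x : ℝ => x ^ 2) μ) (τ y : ℝ) :
    tiltMoment μ 1 τ y ^ 2 / tiltMoment μ 0 τ y ≤ tiltMoment μ 2 τ y :=
  div_le_of_le_mul₀ (tiltMoment_zero_nonneg _ _) (tiltMoment_two_nonneg _ _)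
    (sq_tiltMoment_one_le h2 τ y)

lemma integrable_sq_div_tiltMoment [IsFiniteMeasure μ]
    (h2 : Integrable (fun x : ℝ => x ^ 2) μ) (τ : ℝ) :
    Integrable (fun y => tiltMoment μ 1 τ y ^ 2 / tiltMoment μ 0 τ y) (gaussianReal 0 1) := by
  refine (integrable_tiltMoment h2 τ).mono' ?_ (ae_of_all _ fun y => ?_)
  · exact (((continuous_tiltMoment_right (integrable_pow_one h2) τ).measurable.pow_const 2).div
      (continuous_tiltMoment_right integrable_pow_zero τ).measurable).aestronglyMeasurable
  · rw [Real.norm_eq_abs, abs_of_nonneg (sq_div_tiltMoment_nonneg τ y)]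
    exact sq_div_tiltMoment_le h2 τ y

lemma posteriorMeanSq_nonneg (τ : ℝ) : 0 ≤ posteriorMeanSq μ τ :=
  integral_nonneg fun y => sq_div_tiltMoment_nonneg τ y

lemma posteriorMeanSq_le [IsFiniteMeasure μ] (h2 : Integrable (fun x : ℝ => x ^ 2) μ) (τ : ℝ) :
    posteriorMeanSq μ τ ≤ ∫ x, x ^ 2 ∂μ := by
  rw [← integral_tiltMoment h2 τ]
  exact integral_mono (integrable_sq_div_tiltMoment h2 τ) (integrable_tiltMoment h2 τ)
    fun y => sq_div_tiltMoment_le h2 τ y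

/-- The bound `tiltMoment μ 2 τ` varies with `τ`, but its Gaussian integral is always the second
moment of `μ`, which is what Pratt's form requires. -/
lemma continuous_posteriorMeanSq [IsFiniteMeasure μ] [NeZero μ]
    (h2 : Integrable (fun x : ℝ => x ^ 2) μ) : Continuous (posteriorMeanSq μ) := by
  refine continuous_iff_continuousAt.2 fun τ => ?_
  refine tendsto_integral_of_le_of_tendsto_integral (g := fun τ y => tiltMoment μ 2 τ y)
    (g₀ := tiltMoment μ 2 τ)
    (fun τ => (integrable_sq_div_tiltMoment h2 τ).aestronglyMeasurable)
    (integrable_tiltMoment h2) (integrable_tiltMoment h2 τ) sq_div_tiltMoment_nonneg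
    (sq_div_tiltMoment_le h2) (tiltMoment_two_nonneg τ) (sq_div_tiltMoment_le h2 τ)
    (fun y => ?_) (fun y => (continuous_tiltMoment_left h2 y).tendsto τ) ?_
  · exact (((continuous_tiltMoment_left (integrable_pow_one h2) y).pow 2).div
      (continuous_tiltMoment_left integrable_pow_zero y)
      fun τ => (tiltMoment_zero_pos τ y).ne').tendsto τ
  · simp only [integral_tiltMoment h2]
    exact tendsto_const_nhds

lemma integral_exp_mul_gaussianReal (t : ℝ) :
    ∫ n, Real.exp (t * n) ∂(gaussianReal 0 1) = Real.exp (t ^ 2 / 2) := by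
  have := congrFun (mgf_fun_id_gaussianReal (μ := 0) (v := 1)) t
  simpa [mgf] using this

lemma map_rotation_gaussianReal {a b : ℝ} (hab : a ^ 2 + b ^ 2 = 1) :
    ((gaussianReal 0 1).prod (gaussianReal 0 1)).map (fun p => a * p.1 + b * p.2)
      = gaussianReal 0 1 := by
  have h : (fun p : ℝ × ℝ => a * p.1 + b * p.2)
      = (fun p => p.1 + p.2) ∘ Prod.map (a * ·) (b * ·) := rfl
  rw [h, ← Measure.map_map (by fun_prop) (by fun_prop), ← Measure.map_prod_map _ _ (by fun_prop)
    (by fun_prop)]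
  change Measure.conv _ _ = _
  rw [gaussianReal_map_const_mul, gaussianReal_map_const_mul, gaussianReal_conv_gaussianReal]
  congr 1
  · simp
  · ext; simpa using hab

lemma integrable_tilt_affine (τ x c b : ℝ) :
    Integrable (fun n => tilt τ x (c + b * n)) (gaussianReal 0 1) := by
  have := (integrable_exp_mul_gaussianReal (μ := 0) (v := 1) (τ * x * b)).const_mul
    (Real.exp (τ * x * c - (τ * x) ^ 2 / 2))
  refine this.congr (ae_of_all _ fun n => ?_)
  simp only [tilt, ← Real.exp_add]
  congr 1; ring

lemma integral_tilt_affine {a b : ℝ} (hab : a ^ 2 + b ^ 2 = 1) (τ x y : ℝ) :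
    ∫ n, tilt τ x (a * y + b * n) ∂(gaussianReal 0 1) = tilt (a * τ) x y := by
  have : ∀ n, tilt τ x (a * y + b * n)
      = Real.exp (τ * x * (a * y) - (τ * x) ^ 2 / 2) * Real.exp (τ * x * b * n) := fun n => by
    simp only [tilt, ← Real.exp_add]
    congr 1; ring
  simp only [this]
  rw [integral_const_mul, integral_exp_mul_gaussianReal, ← Real.exp_add, tilt]
  congr 1
  have : b ^ 2 = 1 - a ^ 2 := by linarith
  linear_combination (τ * x) ^ 2 / 2 * this

/-- The posterior moments at the lower signal-to-noise ratio `(a τ)²` are those at `τ²` averaged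
by the Ornstein–Uhlenbeck semigroup. -/
lemma integrable_and_integral_tiltMoment_affine [SFinite μ] {k : ℕ}
    (hk : Integrable (fun x : ℝ => x ^ k) μ)
    {a b : ℝ} (hab : a ^ 2 + b ^ 2 = 1) (τ y : ℝ) :
    Integrable (fun n => tiltMoment μ k τ (a * y + b * n)) (gaussianReal 0 1) ∧
    ∫ n, tiltMoment μ k τ (a * y + b * n) ∂(gaussianReal 0 1) = tiltMoment μ k (a * τ) y := by
  have hi : Integrable (fun p : ℝ × ℝ => p.1 ^ k * tilt τ p.1 (a * y + b * p.2))
      (μ.prod (gaussianReal 0 1)) := by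
    rw [integrable_prod_iff (Measurable.aestronglyMeasurable (by fun_prop))]
    refine ⟨ae_of_all _ fun x => (integrable_tilt_affine τ x (a * y) b).const_mul (x ^ k), ?_⟩
    have : ∀ x : ℝ, ∫ n, ‖x ^ k * tilt τ x (a * y + b * n)‖ ∂(gaussianReal 0 1)
        = ‖x ^ k * tilt (a * τ) x y‖ := fun x => by
      simp only [norm_mul, Real.norm_eq_abs, abs_of_pos (tilt_pos _ _ _)]
      rw [integral_const_mul, integral_tilt_affine hab]
    simp only [this]
    exact (integrable_pow_mul_tilt hk _ _).norm
  refine ⟨hi.integral_prod_right, ?_⟩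
  unfold tiltMoment
  rw [← integral_prod_symm _ hi, integral_prod _ hi]
  refine integral_congr_ae (ae_of_all _ fun x => ?_)
  simp only
  rw [integral_const_mul, integral_tilt_affine hab]

/-- A noisier output carries less information. Rotation invariance of the Gaussian writes the
integral at `τ` as an average over `a y + b n`; averaging over `n` turns the moments at `τ` into
those at `a τ`, and Cauchy–Schwarz plays the role of joint convexity of `u² / v`. -/
lemma posteriorMeanSq_mul_le [IsFiniteMeasure μ] [NeZero μ]
    (h2 : Integrable (fun x : ℝ => x ^ 2) μ) {a : ℝ} (ha0 : 0 ≤ a) (ha1 : a ≤ 1) (τ : ℝ) :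
    posteriorMeanSq μ (a * τ) ≤ posteriorMeanSq μ τ := by
  obtain ⟨b, hab⟩ : ∃ b : ℝ, a ^ 2 + b ^ 2 = 1 :=
    ⟨√(1 - a ^ 2), by rw [Real.sq_sqrt (by nlinarith)]; ring⟩
  have hi := integrable_sq_div_tiltMoment h2 τ
  have hr := map_rotation_gaussianReal hab
  have hi' : Integrable (fun p : ℝ × ℝ => tiltMoment μ 1 τ (a * p.1 + b * p.2) ^ 2 /
      tiltMoment μ 0 τ (a * p.1 + b * p.2)) ((gaussianReal 0 1).prod (gaussianReal 0 1)) := by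
    rw [← hr] at hi
    exact hi.comp_measurable (by fun_prop)
  have e : posteriorMeanSq μ τ = ∫ y, ∫ n, tiltMoment μ 1 τ (a * y + b * n) ^ 2 /
      tiltMoment μ 0 τ (a * y + b * n) ∂(gaussianReal 0 1) ∂(gaussianReal 0 1) := by
    rw [← integral_prod _ hi', posteriorMeanSq]
    conv_lhs => rw [← hr]
    exact integral_map (by fun_prop) (by rw [hr]; exact hi.aestronglyMeasurable)
  rw [e, posteriorMeanSq]
  refine integral_mono_ae (integrable_sq_div_tiltMoment h2 _) hi'.integral_prod_left ?_
  filter_upwards [hi'.prod_right_ae] with y hy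
  obtain ⟨h1i, h1⟩ := integrable_and_integral_tiltMoment_affine (integrable_pow_one h2) hab τ y
  obtain ⟨h0i, h0⟩ := integrable_and_integral_tiltMoment_affine
    (integrable_pow_zero (μ := μ)) hab τ y
  rw [div_le_iff₀ (tiltMoment_zero_pos _ _), ← h1, ← h0]
  refine sq_integral_le_integral_mul_integral h1i hy h0i (fun n => sq_div_tiltMoment_nonneg _ _)
    (fun n => tiltMoment_zero_nonneg _ _) fun n => ?_
  rw [div_mul_cancel₀ _ (tiltMoment_zero_pos _ _).ne']

lemma monotoneOn_posteriorMeanSq [IsFiniteMeasure μ] [NeZero μ]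
    (h2 : Integrable (fun x : ℝ => x ^ 2) μ) : MonotoneOn (posteriorMeanSq μ) (Set.Ici 0) := by
  intro s hs t ht hst
  rcases (show 0 ≤ t from ht).eq_or_lt with h | h
  · have : s = t := le_antisymm hst (h ▸ hs)
    rw [this]
  · have := posteriorMeanSq_mul_le h2 (div_nonneg hs ht) ((div_le_one h).2 hst) t
    rwa [div_mul_cancel₀ _ h.ne'] at this

end

/-! ### Stein's identity and the I-MMSE relation for bounded inputs -/

lemma integrable_exp_mul_abs_gaussianReal (c : ℝ) :
    Integrable (fun y => Real.exp (c * |y|)) (gaussianReal 0 1) := by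
  refine ((integrable_exp_mul_gaussianReal (μ := 0) (v := 1) c).add
    (integrable_exp_mul_gaussianReal (μ := 0) (v := 1) (-c))).mono' (by fun_prop)
    (ae_of_all _ fun y => ?_)
  rw [Real.norm_eq_abs, Real.abs_exp]
  simp only [Pi.add_apply]
  rcases abs_choice y with h | h <;> rw [h]
  · linarith [Real.exp_pos (-c * y)]
  · rw [mul_neg, ← neg_mul]; linarith [Real.exp_pos (c * y)]

lemma integrable_gaussianReal_iff {f : ℝ → ℝ} :
    Integrable f (gaussianReal 0 1) ↔ Integrable fun y => f y * gaussianPDFReal 0 1 y := by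
  rw [gaussianReal_of_var_ne_zero _ one_ne_zero,
    integrable_withDensity_iff_integrable_smul' (by fun_prop)
      (ae_of_all _ fun _ => gaussianPDF_lt_top)]
  simp [mul_comm]

/-- Stein's identity. -/
lemma integral_mul_eq_integral_deriv_gaussianReal {f f' : ℝ → ℝ}
    (hd : ∀ y, HasDerivAt f (f' y) y) (hf : Integrable f (gaussianReal 0 1))
    (hf' : Integrable f' (gaussianReal 0 1))
    (hyf : Integrable (fun y => y * f y) (gaussianReal 0 1)) :
    ∫ y, y * f y ∂(gaussianReal 0 1) = ∫ y, f' y ∂(gaussianReal 0 1) := by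
  have hp : ∀ y, HasDerivAt (gaussianPDFReal 0 1) (-y * gaussianPDFReal 0 1 y) y := by
    intro y
    have h1 : HasDerivAt (fun y : ℝ => -(y - 0) ^ 2 / (2 * ((1 : NNReal) : ℝ))) (-y) y := by
      refine ((((hasDerivAt_id y).sub_const 0).pow 2).neg.div_const _).congr_deriv ?_
      simp
      ring
    have := (h1.exp).const_mul (√(2 * Real.pi * ((1 : NNReal) : ℝ)))⁻¹
    refine this.congr_deriv ?_
    rw [gaussianPDFReal]
    ring
  have h := integral_mul_deriv_eq_deriv_mul_of_integrable (u := f) (v := gaussianPDFReal 0 1)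
    (u' := f') (v' := fun y => -y * gaussianPDFReal 0 1 y) (fun y _ => hd y) (fun y _ => hp y)
    (by
      refine ((integrable_gaussianReal_iff.1 hyf).neg).congr (ae_of_all _ fun y => ?_)
      simp only [Pi.mul_apply, Pi.neg_apply]; ring)
    (integrable_gaussianReal_iff.1 hf') (integrable_gaussianReal_iff.1 hf)
  rw [integral_gaussianReal_eq_integral_smul one_ne_zero,
    integral_gaussianReal_eq_integral_smul one_ne_zero]
  simp only [smul_eq_mul]
  calc ∫ y, gaussianPDFReal 0 1 y * (y * f y) = -∫ y, f y * (-y * gaussianPDFReal 0 1 y) := by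
        rw [← integral_neg]; exact integral_congr_ae (ae_of_all _ fun y => by ring)
    _ = _ := by rw [h, neg_neg]; exact integral_congr_ae (ae_of_all _ fun y => by ring)

/-- The relative entropy of the law of the output `τ β₀ + N` with respect to that of `N`. -/
noncomputable def outputDivergence (μ : Measure ℝ) (τ : ℝ) : ℝ :=
  ∫ y, tiltMoment μ 0 τ y * Real.log (tiltMoment μ 0 τ y) ∂(gaussianReal 0 1)

section BoundedSupport

variable {μ : Measure ℝ} [IsFiniteMeasure μ] {K : ℝ}

lemma integrable_pow_of_ae_abs_le (hK : ∀ᵐ x ∂μ, |x| ≤ K) (k : ℕ) :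
    Integrable (fun x : ℝ => x ^ k) μ :=
  (integrable_const (K ^ k)).mono' (by fun_prop) (hK.mono fun x hx => by
    rw [Real.norm_eq_abs, abs_pow]; gcongr)

lemma hasDerivAt_tiltMoment_right (hK : ∀ᵐ x ∂μ, |x| ≤ K) (k : ℕ) (τ y : ℝ) :
    HasDerivAt (tiltMoment μ k τ) (τ * tiltMoment μ (k + 1) τ y) y := by
  have h := hasDerivAt_integral_of_dominated_loc_of_deriv_le (μ := μ)
    (F := fun y x => x ^ k * tilt τ x y) (F' := fun y x => x ^ k * (tilt τ x y * (τ * x)))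
    (x₀ := y) (bound := fun _ => K ^ k * (Real.exp ((|y| + 1) ^ 2 / 2) * (|τ| * K)))
    (Metric.ball_mem_nhds y one_pos) (Eventually.of_forall fun y => by fun_prop)
    (integrable_pow_mul_tilt (integrable_pow_of_ae_abs_le hK k) τ y)
    (Measurable.aestronglyMeasurable (by fun_prop)) ?_ (integrable_const _) ?_
  · refine h.2.congr_deriv ?_
    rw [tiltMoment, ← integral_const_mul]
    exact integral_congr_ae (ae_of_all _ fun x => by ring)
  · filter_upwards [hK] with x hx z hz
    have hz' : |z| ≤ |y| + 1 := by
      have h1 : |z - y| < 1 := by simpa [Real.dist_eq] using hz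
      have h2 := abs_sub_abs_le_abs_sub z y
      linarith
    have h3 : z ^ 2 ≤ (|y| + 1) ^ 2 := by rw [← sq_abs z]; gcongr
    simp only [norm_mul, norm_pow, Real.norm_eq_abs, abs_of_pos (tilt_pos _ _ _)]
    have : tilt τ x z ≤ Real.exp ((|y| + 1) ^ 2 / 2) :=
      (tilt_le _ _ _).trans (Real.exp_le_exp.2 (by linarith))
    have hK0 := (abs_nonneg x).trans hx
    have ht := (tilt_pos τ x z).le
    gcongr
  · refine ae_of_all _ fun x z _ => ?_
    have h1 : HasDerivAt (fun z => τ * x * z - (τ * x) ^ 2 / 2) (τ * x) z := by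
      simpa using ((hasDerivAt_id z).const_mul (τ * x)).sub_const ((τ * x) ^ 2 / 2)
    exact h1.exp.const_mul _

lemma hasDerivAt_tiltMoment_left (hK : ∀ᵐ x ∂μ, |x| ≤ K) (k : ℕ) (τ y : ℝ) :
    HasDerivAt (fun τ => tiltMoment μ k τ y)
      (y * tiltMoment μ (k + 1) τ y - τ * tiltMoment μ (k + 2) τ y) τ := by
  have h := hasDerivAt_integral_of_dominated_loc_of_deriv_le (μ := μ)
    (F := fun τ x => x ^ k * tilt τ x y)
    (F' := fun τ x => x ^ k * (tilt τ x y * (x * y - τ * x ^ 2)))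
    (x₀ := τ) (bound := fun _ => K ^ k * (Real.exp (y ^ 2 / 2) * (K * |y| + (|τ| + 1) * K ^ 2)))
    (Metric.ball_mem_nhds τ one_pos) (Eventually.of_forall fun y => by fun_prop)
    (integrable_pow_mul_tilt (integrable_pow_of_ae_abs_le hK k) τ y)
    (Measurable.aestronglyMeasurable (by fun_prop)) ?_ (integrable_const _) ?_
  · refine h.2.congr_deriv ?_
    rw [tiltMoment, tiltMoment, ← integral_const_mul, ← integral_const_mul, ← integral_sub
      ((integrable_pow_mul_tilt (integrable_pow_of_ae_abs_le hK _) τ y).const_mul _)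
      ((integrable_pow_mul_tilt (integrable_pow_of_ae_abs_le hK _) τ y).const_mul _)]
    exact integral_congr_ae (ae_of_all _ fun x => by ring)
  · filter_upwards [hK] with x hx z hz
    have hz' : |z| ≤ |τ| + 1 := by
      have h1 : |z - τ| < 1 := by simpa [Real.dist_eq] using hz
      have h2 := abs_sub_abs_le_abs_sub z τ
      linarith
    simp only [norm_mul, norm_pow, Real.norm_eq_abs, abs_of_pos (tilt_pos _ _ _)]
    have h4 := tilt_le z x y
    have hK0 := (abs_nonneg x).trans hx
    have ht := (tilt_pos z x y).le
    have h5 : |x * y - z * x ^ 2| ≤ K * |y| + (|τ| + 1) * K ^ 2 := by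
      refine (abs_sub _ _).trans ?_
      rw [abs_mul, abs_mul, abs_pow]
      gcongr
    gcongr
  · refine ae_of_all _ fun x z _ => ?_
    have h1 : HasDerivAt (fun z => z * x * y - (z * x) ^ 2 / 2) (x * y - z * x ^ 2) z := by
      refine ((((hasDerivAt_id z).mul_const x).mul_const y).sub
        ((((hasDerivAt_id z).mul_const x).pow 2).div_const 2)).congr_deriv ?_
      simp; ring
    exact h1.exp.const_mul _

lemma abs_tilt_arg_le {T τ x : ℝ} (hτ : |τ| ≤ T) (hx : |x| ≤ K) (y : ℝ) :
    |τ * x * y| ≤ T * K * |y| := by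
  rw [abs_mul, abs_mul]
  have := (abs_nonneg τ).trans hτ
  gcongr

lemma abs_tiltMoment_le (hK : ∀ᵐ x ∂μ, |x| ≤ K) (k : ℕ) {T τ : ℝ} (hτ : |τ| ≤ T) (y : ℝ) :
    |tiltMoment μ k τ y| ≤ K ^ k * μ.real Set.univ * Real.exp (T * K * |y|) := by
  have := norm_integral_le_of_norm_le_const (μ := μ) (f := fun x => x ^ k * tilt τ x y)
    (C := K ^ k * Real.exp (T * K * |y|)) (hK.mono fun x hx => by
      rw [norm_mul, norm_pow, Real.norm_eq_abs, Real.norm_eq_abs, abs_of_pos (tilt_pos _ _ _)]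
      have h1 : tilt τ x y ≤ Real.exp (T * K * |y|) := Real.exp_le_exp.2 (by
        have := (le_abs_self _).trans (abs_tilt_arg_le hτ hx y)
        nlinarith [sq_nonneg (τ * x)])
      have := (abs_nonneg x).trans hx
      have := (tilt_pos τ x y).le
      gcongr)
  rw [Real.norm_eq_abs] at this
  refine this.trans_eq (by ring)

lemma le_tiltMoment_zero (hK : ∀ᵐ x ∂μ, |x| ≤ K) {T τ : ℝ} (hτ : |τ| ≤ T) (y : ℝ) :
    μ.real Set.univ * Real.exp (-(T * K * |y|) - (T * K) ^ 2 / 2) ≤ tiltMoment μ 0 τ y := by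
  have : ∫ _, Real.exp (-(T * K * |y|) - (T * K) ^ 2 / 2) ∂μ ≤ tiltMoment μ 0 τ y := by
    refine integral_mono_ae (integrable_const _) (integrable_pow_mul_tilt integrable_pow_zero τ y)
      (hK.mono fun x hx => ?_)
    simp only [pow_zero, one_mul]
    refine Real.exp_le_exp.2 ?_
    have h1 := (neg_abs_le _).trans' (neg_le_neg (abs_tilt_arg_le hτ hx y))
    have h2 : |τ * x| ≤ T * K := by
      have := abs_tilt_arg_le hτ hx 1
      simpa using this
    have h3 : (τ * x) ^ 2 ≤ (T * K) ^ 2 := by rw [← sq_abs (τ * x)]; gcongr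
    linarith
  simpa using this

/-- The zeroth moment lies between exponentials of multiples of `|y|`, so its logarithm grows at
most linearly; `|y| ≤ exp |y|` absorbs this growth into the exponent. Uniformity over `|τ| ≤ T`
allows differentiation under the integral. -/
lemma exists_abs_tiltMoment_mul_log_le [NeZero μ] (hK : ∀ᵐ x ∂μ, |x| ≤ K) (hK0 : 0 ≤ K)
    {T : ℝ} (hT : 0 ≤ T) (k : ℕ) : ∃ C c : ℝ, ∀ τ, |τ| ≤ T → ∀ y,
    |tiltMoment μ k τ y * (Real.log (tiltMoment μ 0 τ y) + 1)| ≤ C * Real.exp (c * |y|) := by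
  set M := μ.real Set.univ with hM
  have hM0 : 0 < M := by
    rw [hM, measureReal_def]
    exact ENNReal.toReal_pos (NeZero.ne _) (measure_ne_top _ _)
  set L := |Real.log M| + (T * K) ^ 2 / 2 + 1 with hL
  refine ⟨K ^ k * M * (L + T * K), T * K + 1, fun τ hτ y => ?_⟩
  have h1 := abs_tiltMoment_le hK k hτ y
  have h2 : |Real.log (tiltMoment μ 0 τ y) + 1| ≤ (L + T * K) * Real.exp |y| := by
    have hlow : Real.log M + (-(T * K * |y|) - (T * K) ^ 2 / 2)
        ≤ Real.log (tiltMoment μ 0 τ y) := by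
      rw [← Real.log_exp (-(T * K * |y|) - (T * K) ^ 2 / 2),
        ← Real.log_mul hM0.ne' (Real.exp_pos _).ne']
      exact Real.log_le_log (by positivity) (le_tiltMoment_zero hK hτ y)
    have hup : Real.log (tiltMoment μ 0 τ y) ≤ Real.log M + T * K * |y| := by
      rw [← Real.log_exp (T * K * |y|), ← Real.log_mul hM0.ne' (Real.exp_pos _).ne']
      refine Real.log_le_log (tiltMoment_zero_pos _ _) ?_
      have := abs_tiltMoment_le hK 0 hτ y
      rw [pow_zero, one_mul] at this
      exact (le_abs_self _).trans this
    have hTK : 0 ≤ T * K := by positivity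
    have h3 : |Real.log (tiltMoment μ 0 τ y) + 1| ≤ L + T * K * |y| := by
      rw [abs_le]
      have := neg_abs_le (Real.log M)
      have := le_abs_self (Real.log M)
      have : 0 ≤ (T * K) ^ 2 := sq_nonneg _
      constructor <;> rw [hL] <;> linarith
    have h4 : |y| ≤ Real.exp |y| := by linarith [Real.add_one_le_exp |y|]
    have h5 : 1 ≤ Real.exp |y| := Real.one_le_exp (abs_nonneg y)
    have hL0 : 0 ≤ L := by positivity
    calc _ ≤ L * 1 + T * K * |y| := by linarith
      _ ≤ L * Real.exp |y| + T * K * Real.exp |y| := by gcongr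
      _ = _ := by ring
  rw [abs_mul]
  calc _ ≤ (K ^ k * M * Real.exp (T * K * |y|)) * ((L + T * K) * Real.exp |y|) := by gcongr
    _ = _ := by rw [add_mul (T * K), one_mul, Real.exp_add]; ring

lemma abs_mul_le_mul_exp {f C c y : ℝ} (h : |f| ≤ C * Real.exp (c * |y|)) :
    |y * f| ≤ C * Real.exp ((c + 1) * |y|) := by
  have h4 : |y| ≤ Real.exp |y| := by linarith [Real.add_one_le_exp |y|]
  rw [abs_mul]
  calc _ ≤ Real.exp |y| * (C * Real.exp (c * |y|)) := by gcongr
    _ = _ := by rw [add_mul, one_mul, Real.exp_add]; ring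

/-- The I-MMSE relation for a boundedly supported input. -/
lemma hasDerivAt_outputDivergence_of_ae_abs_le [NeZero μ] (hK : ∀ᵐ x ∂μ, |x| ≤ K) (τ : ℝ) :
    HasDerivAt (outputDivergence μ) (τ * posteriorMeanSq μ τ) τ := by
  have hK0 : 0 ≤ K := by
    obtain ⟨x, hx⟩ := hK.exists
    exact (abs_nonneg x).trans hx
  have hint := integrable_pow_of_ae_abs_le hK
  have hcont : ∀ k σ, Continuous (tiltMoment μ k σ) := fun k σ =>
    continuous_tiltMoment_right (hint k) σ
  have hlog : ∀ σ, Continuous fun y => Real.log (tiltMoment μ 0 σ y) := fun σ =>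
    (hcont 0 σ).log fun y => (tiltMoment_zero_pos σ y).ne'
  -- The radius `|τ| + 1` covers the unit ball around `τ` on which the derivative is dominated.
  have hT : (0 : ℝ) ≤ |τ| + 1 := by positivity
  obtain ⟨C₁, c₁, h₁⟩ := exists_abs_tiltMoment_mul_log_le hK hK0 hT 1
  obtain ⟨C₂, c₂, h₂⟩ := exists_abs_tiltMoment_mul_log_le hK hK0 hT 2
  obtain ⟨C₀, c₀, h₀⟩ := exists_abs_tiltMoment_mul_log_le hK hK0 hT 0
  have hτ : |τ| ≤ |τ| + 1 := by linarith
  have hI : ∀ (k : ℕ) {C c : ℝ} (_ : ∀ y,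
      |tiltMoment μ k τ y * (Real.log (tiltMoment μ 0 τ y) + 1)| ≤ C * Real.exp (c * |y|)),
      Integrable (fun y => tiltMoment μ k τ y * (Real.log (tiltMoment μ 0 τ y) + 1))
        (gaussianReal 0 1) := fun k C c h =>
    ((integrable_exp_mul_abs_gaussianReal c).const_mul C).mono'
      (((hcont k τ).mul ((hlog τ).add continuous_const)).aestronglyMeasurable)
      (ae_of_all _ h)
  have hI1 := hI 1 (h₁ τ hτ)
  have hI2 := hI 2 (h₂ τ hτ)
  have hI0 : Integrable (fun y => tiltMoment μ 0 τ y * Real.log (tiltMoment μ 0 τ y))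
      (gaussianReal 0 1) := by
    refine ((hI 0 (h₀ τ hτ)).sub (integrable_tiltMoment (hint 0) τ)).congr
      (ae_of_all _ fun y => ?_)
    simp only [Pi.sub_apply]; ring
  have hyI1 : Integrable (fun y => y * (tiltMoment μ 1 τ y * (Real.log (tiltMoment μ 0 τ y) + 1)))
      (gaussianReal 0 1) :=
    ((integrable_exp_mul_abs_gaussianReal (c₁ + 1)).const_mul C₁).mono'
      ((continuous_id.mul ((hcont 1 τ).mul ((hlog τ).add continuous_const))).aestronglyMeasurable)
      (ae_of_all _ fun y => abs_mul_le_mul_exp (h₁ τ hτ y))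
  have h := hasDerivAt_integral_of_dominated_loc_of_deriv_le (μ := gaussianReal 0 1)
    (F := fun τ y => tiltMoment μ 0 τ y * Real.log (tiltMoment μ 0 τ y))
    (F' := fun τ y => y * (tiltMoment μ 1 τ y * (Real.log (tiltMoment μ 0 τ y) + 1))
      - τ * (tiltMoment μ 2 τ y * (Real.log (tiltMoment μ 0 τ y) + 1)))
    (x₀ := τ) (bound := fun y => C₁ * Real.exp ((c₁ + 1) * |y|) +
      (|τ| + 1) * (C₂ * Real.exp (c₂ * |y|)))
    (Metric.ball_mem_nhds τ one_pos)
    (Eventually.of_forall fun σ => ((hcont 0 σ).mul (hlog σ)).aestronglyMeasurable)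
    hI0 (hyI1.sub (hI2.const_mul τ)).aestronglyMeasurable ?_
    (((integrable_exp_mul_abs_gaussianReal _).const_mul _).add
      (((integrable_exp_mul_abs_gaussianReal _).const_mul _).const_mul _)) ?_
  · refine h.2.congr_deriv ?_
    have hq := integrable_sq_div_tiltMoment (hint 2) τ
    -- Stein's identity replaces the factor `y` by a derivative in `y`. Its second-moment term
    -- cancels the other half of `F'`, leaving `τ` times the integrand of `posteriorMeanSq`.
    have hst := integral_mul_eq_integral_deriv_gaussianReal
      (f := fun y => tiltMoment μ 1 τ y * (Real.log (tiltMoment μ 0 τ y) + 1))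
      (f' := fun y => τ * (tiltMoment μ 2 τ y * (Real.log (tiltMoment μ 0 τ y) + 1))
        + τ * (tiltMoment μ 1 τ y ^ 2 / tiltMoment μ 0 τ y))
      (fun y => ?_) hI1 ((hI2.const_mul τ).add (hq.const_mul τ)) hyI1
    · rw [integral_sub hyI1 (hI2.const_mul τ), hst, integral_add (hI2.const_mul τ)
        (hq.const_mul τ), add_sub_cancel_left, integral_const_mul, posteriorMeanSq]
    · have hp := (tiltMoment_zero_pos (μ := μ) τ y).ne'
      have := (hasDerivAt_tiltMoment_right hK 1 τ y).mul
        (((hasDerivAt_tiltMoment_right hK 0 τ y).log hp).add_const 1)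
      refine this.congr_deriv ?_
      field_simp
  · refine ae_of_all _ fun y σ hσ => ?_
    have hσ' : |σ| ≤ |τ| + 1 := by
      have h1 : |σ - τ| < 1 := by simpa [Real.dist_eq] using hσ
      have h2 := abs_sub_abs_le_abs_sub σ τ
      linarith
    rw [Real.norm_eq_abs]
    refine (abs_sub _ _).trans (add_le_add (abs_mul_le_mul_exp (h₁ σ hσ' y)) ?_)
    rw [abs_mul]
    exact mul_le_mul hσ' (h₂ σ hσ' y) (abs_nonneg _) hT
  · refine ae_of_all _ fun y σ _ => ?_
    have hp := (tiltMoment_zero_pos (μ := μ) σ y).ne'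
    have h1 := hasDerivAt_tiltMoment_left hK 0 σ y
    refine (h1.mul (h1.log hp)).congr_deriv ?_
    field_simp

end BoundedSupport

/-! ### Removal of the boundedness assumption by truncation -/

/-- The restriction of `μ` to `[-n, n]`. -/
noncomputable def truncation (μ : Measure ℝ) (n : ℕ) : Measure ℝ :=
  μ.restrict (Set.Icc (-(n : ℝ)) n)

section

variable {μ : Measure ℝ}

lemma ae_truncation_abs_le (n : ℕ) :
    ∀ᵐ x : ℝ ∂(truncation μ n), |x| ≤ (n : ℝ) := by
  refine (ae_restrict_mem measurableSet_Icc).mono fun x hx => abs_le.2 hx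

instance [IsFiniteMeasure μ] (n : ℕ) : IsFiniteMeasure (truncation μ n) := by
  unfold truncation; infer_instance

lemma tendsto_tiltMoment_truncation {k : ℕ} (hk : Integrable (fun x : ℝ => x ^ k) μ) (τ y : ℝ) :
    Tendsto (fun n => tiltMoment (truncation μ n) k τ y) atTop (𝓝 (tiltMoment μ k τ y)) :=
  (aecover_Icc (tendsto_neg_atTop_atBot.comp tendsto_natCast_atTop_atTop)
    tendsto_natCast_atTop_atTop).integral_tendsto_of_countably_generated
    (integrable_pow_mul_tilt hk τ y)

/-- Without renormalization the truncated measures stay below `μ`, so the moments of `μ` dominate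
the nonnegative ones. -/
lemma tiltMoment_zero_truncation_le [IsFiniteMeasure μ] (n : ℕ) (τ y : ℝ) :
    tiltMoment (truncation μ n) 0 τ y ≤ tiltMoment μ 0 τ y :=
  setIntegral_le_integral (integrable_pow_mul_tilt integrable_pow_zero τ y)
    (ae_of_all _ fun x => by simpa using (tilt_pos _ _ _).le)

lemma tiltMoment_two_truncation_le (h2 : Integrable (fun x : ℝ => x ^ 2) μ) (n : ℕ) (τ y : ℝ) :
    tiltMoment (truncation μ n) 2 τ y ≤ tiltMoment μ 2 τ y :=
  setIntegral_le_integral (integrable_pow_mul_tilt h2 τ y)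
    (ae_of_all _ fun x => mul_nonneg (sq_nonneg x) (tilt_pos _ _ _).le)

lemma eventually_truncation_neZero [IsFiniteMeasure μ] [NeZero μ] :
    ∀ᶠ n in atTop, NeZero (truncation μ n) := by
  filter_upwards [(tendsto_tiltMoment_truncation (integrable_pow_zero (μ := μ)) 0 0).eventually
    (lt_mem_nhds (tiltMoment_zero_pos 0 0))] with n hn
  refine ⟨fun h => ?_⟩
  simp [h, tiltMoment] at hn

lemma tendsto_posteriorMeanSq_truncation [IsFiniteMeasure μ] [NeZero μ]
    (h2 : Integrable (fun x : ℝ => x ^ 2) μ) (τ : ℝ) :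
    Tendsto (fun n => posteriorMeanSq (truncation μ n) τ) atTop (𝓝 (posteriorMeanSq μ τ)) := by
  have ht : ∀ n, Integrable (fun x : ℝ => x ^ 2) (truncation μ n) := fun n => h2.restrict
  refine tendsto_integral_of_dominated_convergence (tiltMoment μ 2 τ)
    (fun n => (integrable_sq_div_tiltMoment (ht n) τ).aestronglyMeasurable)
    (integrable_tiltMoment h2 τ) (fun n => ae_of_all _ fun y => ?_) (ae_of_all _ fun y => ?_)
  · rw [Real.norm_eq_abs, abs_of_nonneg (sq_div_tiltMoment_nonneg τ y)]
    exact (sq_div_tiltMoment_le (ht n) τ y).trans (tiltMoment_two_truncation_le h2 n τ y)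
  · exact ((tendsto_tiltMoment_truncation (integrable_pow_one h2) τ y).pow 2).div
      (tendsto_tiltMoment_truncation integrable_pow_zero τ y) (tiltMoment_zero_pos τ y).ne'

/-- The function `t log t` is bounded by `1` in absolute value on `[0, 1]` and increasing and
nonnegative beyond `1`. -/
lemma abs_mul_log_le {t z : ℝ} (ht : 0 ≤ t) (htz : t ≤ z) :
    |t * Real.log t| ≤ 1 + |z * Real.log z| := by
  rcases le_total t 1 with h | h
  · have h1 := Real.negMulLog_nonneg ht h
    have h2 := Real.negMulLog_le_one_sub_self ht
    rw [Real.negMulLog] at h1 h2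
    rw [abs_of_nonpos (by linarith)]
    linarith [abs_nonneg (z * Real.log z)]
  · have h1 := Real.log_nonneg h
    have h2 : Real.log t ≤ Real.log z := Real.log_le_log (by linarith) htz
    rw [abs_of_nonneg (by positivity)]
    have h0 : 0 ≤ z := ht.trans htz
    have h3 : t * Real.log t ≤ z * Real.log z := by gcongr
    linarith [le_abs_self (z * Real.log z)]

lemma continuous_mul_log_tiltMoment [IsFiniteMeasure μ] (τ : ℝ) :
    Continuous fun y => tiltMoment μ 0 τ y * Real.log (tiltMoment μ 0 τ y) :=
  Real.continuous_mul_log.comp (continuous_tiltMoment_right integrable_pow_zero τ)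

lemma memLp_output_two [IsFiniteMeasure μ] (h2 : Integrable (fun x : ℝ => x ^ 2) μ) (τ : ℝ) :
    MemLp (fun ω : ℝ × ℝ => τ * ω.1 + ω.2) 2 (μ.prod (gaussianReal 0 1)) := by
  have h1 : MemLp (fun x : ℝ => x) 2 μ := (memLp_two_iff_integrable_sq (by fun_prop)).2 h2
  have h3 : MemLp (fun x : ℝ => x) 2 (gaussianReal 0 1) := memLp_id_gaussianReal 2
  exact ((h1.comp_fst _).const_mul τ).add (h3.comp_snd μ)

/-- With `p` the zeroth moment, `p log p ≥ p - 1 ≥ -1` bounds it from below, and `log p ≤ y² / 2`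
with the finite second moment of the output bounds it from above. -/
lemma integrable_mul_log_tiltMoment [IsProbabilityMeasure μ]
    (h2 : Integrable (fun x : ℝ => x ^ 2) μ) (τ : ℝ) :
    Integrable (fun y => tiltMoment μ 0 τ y * Real.log (tiltMoment μ 0 τ y))
      (gaussianReal 0 1) := by
  have hsq := (integrable_tiltMoment_mul_and_integral_eq (μ := μ) (k := 0) (τ := τ)
    (h := fun y => y ^ 2) (by fun_prop)
    (by simpa using (memLp_output_two h2 τ).integrable_sq)).1
  refine ((integrable_const (1 : ℝ)).add (hsq.div_const 2)).mono'
    (continuous_mul_log_tiltMoment τ).aestronglyMeasurable (ae_of_all _ fun y => ?_)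
  have hp := tiltMoment_zero_pos (μ := μ) τ y
  have hup : Real.log (tiltMoment μ 0 τ y) ≤ y ^ 2 / 2 := by
    rw [← Real.log_exp (y ^ 2 / 2)]
    exact Real.log_le_log hp (tiltMoment_zero_le τ y)
  have hlow := Real.one_sub_inv_le_log_of_pos hp
  have h3 : tiltMoment μ 0 τ y - 1 ≤ tiltMoment μ 0 τ y * Real.log (tiltMoment μ 0 τ y) := by
    have := mul_le_mul_of_nonneg_left hlow hp.le
    rwa [mul_sub, mul_inv_cancel₀ hp.ne', mul_one] at this
  have h4 := mul_le_mul_of_nonneg_left hup hp.le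
  have h5 : 0 ≤ tiltMoment μ 0 τ y * y ^ 2 := by positivity
  simp only [Pi.add_apply, Real.norm_eq_abs]
  rw [abs_le]
  constructor <;> linarith

lemma tendsto_outputDivergence_truncation [IsProbabilityMeasure μ]
    (h2 : Integrable (fun x : ℝ => x ^ 2) μ) (τ : ℝ) :
    Tendsto (fun n => outputDivergence (truncation μ n) τ) atTop (𝓝 (outputDivergence μ τ)) := by
  refine tendsto_integral_of_dominated_convergence
    (fun y => 1 + |tiltMoment μ 0 τ y * Real.log (tiltMoment μ 0 τ y)|)
    (fun n => (continuous_mul_log_tiltMoment τ).aestronglyMeasurable)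
    ((integrable_const _).add (integrable_mul_log_tiltMoment h2 τ).abs)
    (fun n => ae_of_all _ fun y => ?_) (ae_of_all _ fun y => ?_)
  · exact abs_mul_log_le (tiltMoment_zero_nonneg τ y) (tiltMoment_zero_truncation_le n τ y)
  · exact (Real.continuous_mul_log.tendsto _).comp
      (tendsto_tiltMoment_truncation integrable_pow_zero τ y)

/-- Pointwise limits need not preserve derivatives, but the integrated relation passes to the limit
on both sides. Continuity of `posteriorMeanSq` then recovers the derivative. -/
lemma outputDivergence_sub_eq_integral [IsProbabilityMeasure μ]
    (h2 : Integrable (fun x : ℝ => x ^ 2) μ) (a b : ℝ) :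
    outputDivergence μ b - outputDivergence μ a = ∫ τ in a..b, τ * posteriorMeanSq μ τ := by
  have ht : ∀ n, Integrable (fun x : ℝ => x ^ 2) (truncation μ n) := fun n => h2.restrict
  have hl := (tendsto_outputDivergence_truncation h2 b).sub
    (tendsto_outputDivergence_truncation h2 a)
  refine tendsto_nhds_unique hl ?_
  have hr : Tendsto (fun n => ∫ τ in a..b, τ * posteriorMeanSq (truncation μ n) τ) atTop
      (𝓝 (∫ τ in a..b, τ * posteriorMeanSq μ τ)) := by
    refine intervalIntegral.tendsto_integral_filter_of_dominated_convergence
      (fun τ => |τ| * ∫ x, x ^ 2 ∂μ) ?_ ?_ ?_ ?_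
    · filter_upwards [eventually_truncation_neZero (μ := μ)] with n hn
      exact (continuous_id.mul (continuous_posteriorMeanSq (ht n))).aestronglyMeasurable
    · refine Eventually.of_forall fun n => ae_of_all _ fun τ _ => ?_
      rw [norm_mul, Real.norm_eq_abs, Real.norm_eq_abs, abs_of_nonneg (posteriorMeanSq_nonneg τ)]
      gcongr
      exact (posteriorMeanSq_le (ht n) τ).trans
        (setIntegral_le_integral h2 (ae_of_all _ fun x => sq_nonneg x))
    · exact Continuous.intervalIntegrable (by fun_prop) a b
    · exact ae_of_all _ fun τ _ => (tendsto_posteriorMeanSq_truncation h2 τ).const_mul τ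
  refine hr.congr' ?_
  filter_upwards [eventually_truncation_neZero (μ := μ)] with n hn
  refine intervalIntegral.integral_eq_sub_of_hasDerivAt
    (fun τ _ => hasDerivAt_outputDivergence_of_ae_abs_le (ae_truncation_abs_le n) τ) ?_
  exact (continuous_id.mul (continuous_posteriorMeanSq (ht n))).intervalIntegrable a b

lemma hasDerivAt_outputDivergence [IsProbabilityMeasure μ]
    (h2 : Integrable (fun x : ℝ => x ^ 2) μ) (τ : ℝ) :
    HasDerivAt (outputDivergence μ) (τ * posteriorMeanSq μ τ) τ := by
  have hc : Continuous fun τ => τ * posteriorMeanSq μ τ :=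
    continuous_id.mul (continuous_posteriorMeanSq h2)
  have := (hc.integral_hasStrictDerivAt 0 τ).hasDerivAt.add_const (outputDivergence μ 0)
  refine this.congr_of_eventuallyEq (Eventually.of_forall fun σ => ?_)
  simp only
  rw [← outputDivergence_sub_eq_integral h2]
  ring

end

/-! ### MMSE and mutual information in terms of posterior moments -/

section

variable {μ : Measure ℝ}

/-- Positivity of `tilt` makes integrability on the output side sufficient, by Tonelli. -/
lemma integrable_comp_output [IsFiniteMeasure μ] {τ : ℝ} {h : ℝ → ℝ} (hh : Measurable h)
    (hi : Integrable (fun y => tiltMoment μ 0 τ y * h y) (gaussianReal 0 1)) :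
    Integrable (fun ω : ℝ × ℝ => h (τ * ω.1 + ω.2)) (μ.prod (gaussianReal 0 1)) := by
  have hg : Measurable fun ω : ℝ × ℝ => h ω.2 := by fun_prop
  have ht : ∀ y, Integrable (fun x => tilt τ x y) μ := fun y => by
    simpa using integrable_pow_mul_tilt (integrable_pow_zero (μ := μ)) τ y
  refine (integrable_channel_iff μ τ hg).2 ?_
  rw [integrable_prod_iff' (Measurable.aestronglyMeasurable (by fun_prop))]
  refine ⟨ae_of_all _ fun y => (ht y).mul_const (h y), ?_⟩
  refine hi.norm.congr (ae_of_all _ fun y => ?_)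
  simp only [norm_mul, Real.norm_eq_abs, abs_of_pos (tilt_pos _ _ _),
    abs_of_nonneg (tiltMoment_zero_nonneg _ _)]
  rw [integral_mul_const]
  simp [tiltMoment]

lemma integral_comp_output [IsFiniteMeasure μ] {τ : ℝ} {h : ℝ → ℝ} (hh : Measurable h)
    (hi : Integrable (fun y => tiltMoment μ 0 τ y * h y) (gaussianReal 0 1)) :
    ∫ ω, h (τ * ω.1 + ω.2) ∂(μ.prod (gaussianReal 0 1))
      = ∫ y, tiltMoment μ 0 τ y * h y ∂(gaussianReal 0 1) := by
  have := (integrable_tiltMoment_mul_and_integral_eq (μ := μ) (k := 0) hh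
    (by simpa using integrable_comp_output hh hi)).2
  simpa using this.symm

/-- The posterior mean of the input given the output. -/
noncomputable def posteriorMean (μ : Measure ℝ) (τ y : ℝ) : ℝ :=
  tiltMoment μ 1 τ y / tiltMoment μ 0 τ y

lemma measurable_posteriorMean [IsFiniteMeasure μ] (h2 : Integrable (fun x : ℝ => x ^ 2) μ)
    (τ : ℝ) : Measurable (posteriorMean μ τ) :=
  (continuous_tiltMoment_right (integrable_pow_one h2) τ).measurable.div
    (continuous_tiltMoment_right integrable_pow_zero τ).measurable

lemma memLp_fst (h2 : Integrable (fun x : ℝ => x ^ 2) μ) :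
    MemLp (fun ω : ℝ × ℝ => ω.1) 2 (μ.prod (gaussianReal 0 1)) :=
  ((memLp_two_iff_integrable_sq (f := fun x : ℝ => x) (by fun_prop)).2 h2).comp_fst _

lemma mmse_nonneg (s : ℝ) : 0 ≤ mmse μ s := integral_nonneg fun _ => sq_nonneg _

variable [IsProbabilityMeasure μ]

lemma tiltMoment_zero_mul_posteriorMean (τ y : ℝ) :
    tiltMoment μ 0 τ y * posteriorMean μ τ y = tiltMoment μ 1 τ y :=
  mul_div_cancel₀ _ (tiltMoment_zero_pos τ y).ne'

lemma tiltMoment_zero_mul_posteriorMean_sq (τ y : ℝ) :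
    tiltMoment μ 0 τ y * posteriorMean μ τ y ^ 2
      = tiltMoment μ 1 τ y ^ 2 / tiltMoment μ 0 τ y := by
  have := (tiltMoment_zero_pos (μ := μ) τ y).ne'
  rw [posteriorMean]
  field_simp

lemma memLp_posteriorMean_output (h2 : Integrable (fun x : ℝ => x ^ 2) μ) (τ : ℝ) :
    MemLp (fun ω : ℝ × ℝ => posteriorMean μ τ (τ * ω.1 + ω.2)) 2 (μ.prod (gaussianReal 0 1)) := by
  have hm := measurable_posteriorMean h2 τ
  refine (memLp_two_iff_integrable_sq (Measurable.aestronglyMeasurable (by fun_prop))).2 ?_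
  refine integrable_comp_output (h := fun y => posteriorMean μ τ y ^ 2) (by fun_prop) ?_
  simpa only [tiltMoment_zero_mul_posteriorMean_sq] using integrable_sq_div_tiltMoment h2 τ

/-- Together with `integral_posteriorMean_sq` this is the orthogonality of the error to the
posterior mean, which gives `mmse_eq` after expanding the square. -/
lemma integral_fst_mul_posteriorMean (h2 : Integrable (fun x : ℝ => x ^ 2) μ) (τ : ℝ) :
    ∫ ω, ω.1 * posteriorMean μ τ (τ * ω.1 + ω.2) ∂(μ.prod (gaussianReal 0 1))
      = posteriorMeanSq μ τ := by
  have h := (integrable_tiltMoment_mul_and_integral_eq (μ := μ) (k := 1)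
    (measurable_posteriorMean h2 τ)
    (by simp only [pow_one]
        exact (memLp_fst h2).integrable_mul (memLp_posteriorMean_output h2 τ))).2
  simp only [pow_one] at h
  rw [← h, posteriorMeanSq]
  exact integral_congr_ae (ae_of_all _ fun y => by simp only [posteriorMean]; ring)

lemma integral_posteriorMean_sq (h2 : Integrable (fun x : ℝ => x ^ 2) μ) (τ : ℝ) :
    ∫ ω, posteriorMean μ τ (τ * ω.1 + ω.2) ^ 2 ∂(μ.prod (gaussianReal 0 1))
      = posteriorMeanSq μ τ := by
  have hm := measurable_posteriorMean h2 τ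
  rw [integral_comp_output (h := fun y => posteriorMean μ τ y ^ 2) (by fun_prop)]
  · simp only [tiltMoment_zero_mul_posteriorMean_sq, posteriorMeanSq]
  · simpa only [tiltMoment_zero_mul_posteriorMean_sq] using integrable_sq_div_tiltMoment h2 τ

lemma measurable_output (s : ℝ) : Measurable (output s) := by
  unfold output; fun_prop

instance : IsProbabilityMeasure (inputNoise μ) := by
  unfold inputNoise; infer_instance

lemma condExp_fst_ae_eq (h2 : Integrable (fun x : ℝ => x ^ 2) μ) (s : ℝ) :
    (fun ω => posteriorMean μ √s (output s ω)) =ᵐ[inputNoise μ]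
      (inputNoise μ)[fun ω : ℝ × ℝ => ω.1 | MeasurableSpace.comap (output s) inferInstance] := by
  have hm := measurable_posteriorMean h2 √s
  have hint : Integrable (fun ω => posteriorMean μ √s (output s ω)) (inputNoise μ) :=
    (memLp_posteriorMean_output h2 √s).integrable one_le_two
  have hfst : Integrable (fun ω : ℝ × ℝ => ω.1) (inputNoise μ) :=
    (memLp_fst h2).integrable one_le_two
  refine ae_eq_condExp_of_forall_setIntegral_eq (measurable_output s).comap_le hfst
    (fun _ _ _ => hint.integrableOn) ?_ ?_
  · rintro _ ⟨T, hT, rfl⟩ -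
    rw [← integral_indicator (measurable_output s hT),
      ← integral_indicator (measurable_output s hT)]
    have h1 : ∀ ω : ℝ × ℝ, (output s ⁻¹' T).indicator (fun ω => posteriorMean μ √s (output s ω)) ω
        = T.indicator (posteriorMean μ √s) (√s * ω.1 + ω.2) := fun ω => rfl
    have h2' : ∀ ω : ℝ × ℝ, (output s ⁻¹' T).indicator (fun ω => ω.1) ω
        = ω.1 ^ 1 * T.indicator (fun _ => (1 : ℝ)) (√s * ω.1 + ω.2) := fun ω => by
      by_cases h : √s * ω.1 + ω.2 ∈ T <;> simp [Set.indicator, output, h]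
    -- Bayes' formula: over an output event both integrals reduce to that of the first moment.
    have h3 : ∀ y, tiltMoment μ 0 √s y * T.indicator (posteriorMean μ √s) y
        = tiltMoment μ 1 √s y * T.indicator (fun _ => (1 : ℝ)) y := fun y => by
      by_cases h : y ∈ T <;> simp [h, tiltMoment_zero_mul_posteriorMean]
    have hT1 : Measurable (T.indicator fun _ => (1 : ℝ)) := measurable_const.indicator hT
    obtain ⟨h4, h5⟩ := integrable_tiltMoment_mul_and_integral_eq (μ := μ) (k := 1) (τ := √s) hT1
      (by simp only [← h2']
          exact hfst.indicator (measurable_output s hT))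
    simp only [h1, h2', inputNoise]
    rw [← h5, integral_comp_output (hm.indicator hT) (by simpa only [h3] using h4)]
    simp only [h3]
  · exact (hm.comp (comap_measurable (output s))).aestronglyMeasurable

lemma mmse_eq (h2 : Integrable (fun x : ℝ => x ^ 2) μ) (s : ℝ) :
    mmse μ s = ∫ x, x ^ 2 ∂μ - posteriorMeanSq μ √s := by
  have h : mmse μ s = ∫ ω, (ω.1 - posteriorMean μ √s (√s * ω.1 + ω.2)) ^ 2 ∂(inputNoise μ) := by
    refine integral_congr_ae ?_
    filter_upwards [condExp_fst_ae_eq h2 s] with ω hω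
    rw [← hω]
    rfl
  have hx := memLp_fst h2
  have hp := memLp_posteriorMean_output h2 √s
  have h1 : Integrable (fun ω : ℝ × ℝ => ω.1 ^ 2) (μ.prod (gaussianReal 0 1)) := hx.integrable_sq
  have h3 : Integrable (fun ω : ℝ × ℝ => posteriorMean μ √s (√s * ω.1 + ω.2) ^ 2)
    (μ.prod (gaussianReal 0 1)) := hp.integrable_sq
  have h4 : Integrable (fun ω : ℝ × ℝ => 2 * (ω.1 * posteriorMean μ √s (√s * ω.1 + ω.2)))
    (μ.prod (gaussianReal 0 1)) := (hx.integrable_mul hp).const_mul 2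
  have e : ∀ ω : ℝ × ℝ, (ω.1 - posteriorMean μ √s (√s * ω.1 + ω.2)) ^ 2
      = ω.1 ^ 2 - 2 * (ω.1 * posteriorMean μ √s (√s * ω.1 + ω.2))
        + posteriorMean μ √s (√s * ω.1 + ω.2) ^ 2 := fun ω => by ring
  rw [h, inputNoise]
  simp only [e]
  have h5 : Integrable (fun ω : ℝ × ℝ => ω.1 ^ 2
    - 2 * (ω.1 * posteriorMean μ √s (√s * ω.1 + ω.2))) (μ.prod (gaussianReal 0 1)) := h1.sub h4
  rw [integral_add h5 h3, integral_sub h1 h4, integral_const_mul,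
    integral_fst_mul_posteriorMean h2, integral_posteriorMean_sq h2]
  have : ∫ ω : ℝ × ℝ, ω.1 ^ 2 ∂(μ.prod (gaussianReal 0 1)) = ∫ x, x ^ 2 ∂μ :=
    (integral_fun_fst fun x : ℝ => x ^ 2).trans (by simp)
  rw [this]
  ring

lemma measurable_tiltMoment_zero (τ : ℝ) : Measurable (tiltMoment μ 0 τ) :=
  (continuous_tiltMoment_right integrable_pow_zero τ).measurable

lemma map_output (s : ℝ) : (inputNoise μ).map (output s)
    = (gaussianReal 0 1).withDensity fun y => ENNReal.ofReal (tiltMoment μ 0 √s y) := by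
  have hm := measurable_tiltMoment_zero (μ := μ) √s
  have e : (inputNoise μ).map (output s)
      = ((inputNoise μ).map (fun ω => (ω.1, √s * ω.1 + ω.2))).map Prod.snd := by
    rw [Measure.map_map (by fun_prop) (by fun_prop)]
    rfl
  rw [e, inputNoise, map_channel_prod]
  refine Measure.ext_of_lintegral _ fun f hf => ?_
  rw [lintegral_map hf (by fun_prop),
    lintegral_withDensity_eq_lintegral_mul _ (by fun_prop) (by fun_prop),
    lintegral_withDensity_eq_lintegral_mul _ (by fun_prop) hf, lintegral_prod_symm _ (by fun_prop)]
  refine lintegral_congr fun y => ?_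
  simp only [Pi.mul_apply]
  rw [lintegral_mul_const _ (by fun_prop), tiltMoment,
    ofReal_integral_eq_lintegral_ofReal (integrable_pow_mul_tilt integrable_pow_zero √s y)
      (ae_of_all _ fun x => by simpa using (tilt_pos _ _ _).le)]
  simp

/-- The joint law has density `tilt / tiltMoment μ 0` with respect to the product of marginals.
Along the channel the logarithm of `tilt` is `s β₀² / 2 + √s β₀ N`, whose cross term has mean zero,
and the logarithm of the denominator averages to `outputDivergence`. -/
lemma mutualInfo_eq_sub_outputDivergence (h2 : Integrable (fun x : ℝ => x ^ 2) μ) {s : ℝ}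
    (hs : 0 ≤ s) :
    mutualInfo μ s = s / 2 * ∫ x, x ^ 2 ∂μ - outputDivergence μ √s := by
  have hm := measurable_tiltMoment_zero (μ := μ) √s
  set J := (inputNoise μ).map (fun ω => (ω.1, output s ω)) with hJ
  set Q := μ.prod ((inputNoise μ).map (output s)) with hQ
  set R : ℝ × ℝ → ℝ≥0∞ := fun ω =>
    ENNReal.ofReal (tilt √s ω.1 ω.2 / tiltMoment μ 0 √s ω.2) with hR
  have hpair : Measurable fun ω : ℝ × ℝ => (ω.1, output s ω) := by
    have := measurable_output s
    fun_prop
  have hJe : J = (μ.prod (gaussianReal 0 1)).withDensity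
      fun ω => ENNReal.ofReal (tilt √s ω.1 ω.2) := map_channel_prod μ √s
  have hQe : Q = (μ.prod (gaussianReal 0 1)).withDensity
      fun ω => ENNReal.ofReal (tiltMoment μ 0 √s ω.2) := by
    rw [hQ, map_output, prod_withDensity_right (by fun_prop)]
  have hJQ : J = Q.withDensity R := by
    rw [hJe, hQe, ← withDensity_mul _ (by fun_prop) (by fun_prop)]
    congr 1
    ext ω
    simp only [Pi.mul_apply, hR]
    rw [← ENNReal.ofReal_mul (tiltMoment_zero_nonneg _ _),
      mul_div_cancel₀ _ (tiltMoment_zero_pos _ _).ne']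
  have : IsProbabilityMeasure J := Measure.isProbabilityMeasure_map hpair.aemeasurable
  have : IsProbabilityMeasure ((inputNoise μ).map (output s)) :=
    Measure.isProbabilityMeasure_map (measurable_output s).aemeasurable
  have hac : J ≪ Q := hJQ ▸ withDensity_absolutelyContinuous _ _
  have hllr : llr J Q =ᵐ[J] fun ω =>
      (√s * ω.1 * ω.2 - (√s * ω.1) ^ 2 / 2) - Real.log (tiltMoment μ 0 √s ω.2) := by
    have h1 : J.rnDeriv Q =ᵐ[Q] R := by
      rw [hJQ]
      exact Measure.rnDeriv_withDensity Q (by fun_prop)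
    filter_upwards [hac.ae_le h1] with ω hω
    rw [llr, hω, ENNReal.toReal_ofReal (div_nonneg (tilt_pos _ _ _).le
      (tiltMoment_zero_nonneg _ _)), Real.log_div (tilt_pos _ _ _).ne'
      (tiltMoment_zero_pos _ _).ne', tilt, Real.log_exp]
  rw [mutualInfo, InformationTheory.toReal_klDiv_of_measure_eq hac (by simp [hQ]),
    integral_congr_ae hllr, hJ, integral_map hpair.aemeasurable
      (Measurable.aestronglyMeasurable (by fun_prop))]
  have hlogm : Measurable fun y => Real.log (tiltMoment μ 0 √s y) := hm.log
  have hlog := integrable_comp_output (μ := μ) hlogm (integrable_mul_log_tiltMoment h2 √s)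
  have hlog' := integral_comp_output (μ := μ) hlogm (integrable_mul_log_tiltMoment h2 √s)
  have hx : Integrable (fun ω : ℝ × ℝ => ω.1 ^ 2) (μ.prod (gaussianReal 0 1)) :=
    (memLp_fst h2).integrable_sq
  have hx1 : Integrable (fun x : ℝ => x) μ := by simpa using integrable_pow_one h2
  have hn1 : Integrable (fun x : ℝ => x) (gaussianReal 0 1) :=
    (memLp_id_gaussianReal 1).integrable le_rfl
  have hxn : Integrable (fun ω : ℝ × ℝ => ω.1 * ω.2) (μ.prod (gaussianReal 0 1)) :=
    hx1.mul_prod hn1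
  have e : ∀ ω : ℝ × ℝ, √s * ω.1 * output s ω - (√s * ω.1) ^ 2 / 2
      = s / 2 * ω.1 ^ 2 + √s * (ω.1 * ω.2) := fun ω => by
    have := Real.sq_sqrt hs
    simp only [output]
    linear_combination ω.1 ^ 2 / 2 * this
  have e2 : ∫ ω : ℝ × ℝ, ω.1 ^ 2 ∂(μ.prod (gaussianReal 0 1)) = ∫ x, x ^ 2 ∂μ :=
    (integral_fun_fst fun x : ℝ => x ^ 2).trans (by simp)
  have e3 : ∫ ω : ℝ × ℝ, ω.1 * ω.2 ∂(μ.prod (gaussianReal 0 1)) = 0 := by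
    rw [integral_prod_mul (fun x : ℝ => x) (fun y : ℝ => y), integral_id_gaussianReal, mul_zero]
  simp only [e, inputNoise]
  simp only [output]
  have hq : Integrable (fun ω : ℝ × ℝ => s / 2 * ω.1 ^ 2 + √s * (ω.1 * ω.2))
    (μ.prod (gaussianReal 0 1)) := (hx.const_mul _).add (hxn.const_mul _)
  rw [integral_sub hq hlog, hlog',
    integral_add (hx.const_mul _) (hxn.const_mul _), integral_const_mul, integral_const_mul,
    e2, e3, outputDivergence]
  ring

/-- The I-MMSE relation of Guo, Shamai and Verdú. -/
lemma hasDerivAt_mutualInfo (h2 : Integrable (fun x : ℝ => x ^ 2) μ) {s : ℝ} (hs : 0 < s) :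
    HasDerivAt (mutualInfo μ) (mmse μ s / 2) s := by
  -- The derivative `1 / (2√s)` of the square root cancels the factor `τ = √s`.
  have h1 := (hasDerivAt_outputDivergence h2 √s).comp s (Real.hasDerivAt_sqrt hs.ne')
  have h3 := (((hasDerivAt_id s).div_const 2).mul_const (∫ x, x ^ 2 ∂μ)).sub h1
  have h4 : mutualInfo μ =ᶠ[𝓝 s] fun s => s / 2 * ∫ x, x ^ 2 ∂μ - outputDivergence μ √s := by
    filter_upwards [lt_mem_nhds hs] with t ht
    exact mutualInfo_eq_sub_outputDivergence h2 ht.le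
  refine (HasDerivAt.congr_of_eventuallyEq h3 h4).congr_deriv ?_
  have := (Real.sqrt_pos.2 hs).ne'
  rw [mmse_eq h2]
  field_simp

lemma continuous_mmse (h2 : Integrable (fun x : ℝ => x ^ 2) μ) : Continuous (mmse μ) := by
  simp only [funext (mmse_eq h2)]
  exact continuous_const.sub ((continuous_posteriorMeanSq h2).comp Real.continuous_sqrt)

lemma antitone_mmse (h2 : Integrable (fun x : ℝ => x ^ 2) μ) : Antitone (mmse μ) := by
  intro s t hst
  rw [mmse_eq h2, mmse_eq h2]
  exact sub_le_sub_left (monotoneOn_posteriorMeanSq h2 (Real.sqrt_nonneg s) (Real.sqrt_nonneg t)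
    (Real.sqrt_le_sqrt hst)) _

lemma mmse_le (h2 : Integrable (fun x : ℝ => x ^ 2) μ) (s : ℝ) : mmse μ s ≤ ∫ x, x ^ 2 ∂μ := by
  rw [mmse_eq h2]
  exact sub_le_self _ (posteriorMeanSq_nonneg _)

end

/-! ### State evolution fixed points and bounds on the smallest one -/

section

variable {π : Measure ℝ}

lemma IsStandardized.integrable_sq (h : IsStandardized π) : Integrable (fun x : ℝ => x ^ 2) π :=
  h.memLp_two.integrable_sq

lemma IsStandardized.integral_sq (h : IsStandardized π) : ∫ x, x ^ 2 ∂π = 1 := by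
  rw [← h.variance_eq_one, variance_of_integral_eq_zero (by fun_prop) h.mean_eq_zero]

lemma IsStandardized.mmse_le_one (h : IsStandardized π) (s : ℝ) : mmse π s ≤ 1 := by
  have := h.isProbabilityMeasure
  exact (mmse_le h.integrable_sq s).trans_eq h.integral_sq

lemma hasDerivAt_potential (h : IsStandardized π) {δ snr s : ℝ} (hδ : 0 < δ) (hsnr : 0 < snr)
    (hs : 0 < s) :
    HasDerivAt (potential δ snr π) (mmse π s / 2 + δ / 2 * (1 / (δ * snr) - 1 / s)) s := by
  have := h.isProbabilityMeasure
  have hc : δ * snr ≠ 0 := by positivity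
  have h1 : HasDerivAt (fun s => phi (s / (δ * snr))) (1 / (δ * snr) - 1 / s) s := by
    have h2 := (hasDerivAt_id s).div_const (δ * snr)
    refine ((h2.sub (h2.log (div_ne_zero hs.ne' hc))).sub_const 1).congr_deriv ?_
    have := hs.ne'
    simp only [id]
    field_simp
  exact (hasDerivAt_mutualInfo h.integrable_sq hs).add (h1.const_mul (δ / 2))

/-- The stationary points of the potential are the fixed points of the state evolution. -/
lemma mem_stationaryPoints_iff (h : IsStandardized π) {δ snr s : ℝ} (hδ : 0 < δ)
    (hsnr : 0 < snr) :
    s ∈ stationaryPoints δ snr π ↔ 0 < s ∧ s * (mmse π s + 1 / snr) = δ := by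
  refine and_congr_right fun hs => ?_
  have hd := hasDerivAt_potential h hδ hsnr hs
  have e : mmse π s / 2 + δ / 2 * (1 / (δ * snr) - 1 / s)
      = (s * (mmse π s + 1 / snr) - δ) / (2 * s) := by
    field_simp
    ring
  rw [e] at hd
  constructor
  · intro h0
    have := hd.unique h0
    rw [div_eq_zero_iff] at this
    rcases this with h1 | h1 <;> linarith
  · intro h0
    rwa [h0, sub_self, zero_div] at hd

lemma exists_mem_stationaryPoints_le (h : IsStandardized π) {δ snr s : ℝ} (hδ : 0 < δ)
    (hsnr : 0 < snr) (hs : 0 ≤ s) (hle : δ ≤ s * (mmse π s + 1 / snr)) :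
    ∃ t ∈ stationaryPoints δ snr π, t ≤ s := by
  have := h.isProbabilityMeasure
  have hc : Continuous fun s => s * (mmse π s + 1 / snr) :=
    continuous_id.mul ((continuous_mmse h.integrable_sq).add continuous_const)
  obtain ⟨t, ht, hte⟩ := intermediate_value_Icc hs hc.continuousOn
    (show δ ∈ Set.Icc _ _ from ⟨by simpa using hδ.le, hle⟩)
  refine ⟨t, (mem_stationaryPoints_iff h hδ hsnr).2 ⟨lt_of_le_of_ne ht.1 ?_, hte⟩, ht.2⟩
  rintro rfl
  simp at hte
  exact hδ.ne hte

lemma isLeast_sAMP (h : IsStandardized π) {δ snr : ℝ} (hδ : 0 < δ) (hsnr : 0 < snr) :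
    IsLeast (stationaryPoints δ snr π) (sAMP δ snr π) := by
  have := h.isProbabilityMeasure
  have hb : BddBelow (stationaryPoints δ snr π) := ⟨0, fun s hs => hs.1.le⟩
  have hc : Continuous fun s => s * (mmse π s + 1 / snr) :=
    continuous_id.mul ((continuous_mmse h.integrable_sq).add continuous_const)
  -- Admitting `s = 0` adds no solution, since the left side vanishes there and `δ > 0`, and makes
  -- the set visibly closed.
  have e : stationaryPoints δ snr π = Set.Ici 0 ∩ (fun s => s * (mmse π s + 1 / snr)) ⁻¹' {δ} := by
    ext s
    rw [mem_stationaryPoints_iff h hδ hsnr]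
    refine ⟨fun hs => ⟨hs.1.le, hs.2⟩, fun hs => ⟨lt_of_le_of_ne hs.1 ?_, hs.2⟩⟩
    rintro rfl
    exact hδ.ne (by simpa using hs.2)
  have hcl : IsClosed (stationaryPoints δ snr π) := by
    rw [e]
    exact isClosed_Ici.inter (isClosed_singleton.preimage hc)
  -- At `s = δ snr` the term `s / snr` alone equals `δ`.
  obtain ⟨t, ht, -⟩ := exists_mem_stationaryPoints_le (s := δ * snr) h hδ hsnr (by positivity) (by
    have h1 : 0 ≤ δ * snr * mmse π (δ * snr) := mul_nonneg (by positivity) (mmse_nonneg _)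
    have h2 : δ * snr * (1 / snr) = δ := by field_simp
    rw [mul_add, h2]
    linarith)
  exact ⟨hcl.csInf_mem ⟨t, ht⟩ hb, fun s hs => csInf_le hb hs⟩

lemma sAMP_le (h : IsStandardized π) {δ snr s : ℝ} (hδ : 0 < δ) (hsnr : 0 < snr) (hs : 0 ≤ s)
    (hle : δ ≤ s * (mmse π s + 1 / snr)) : sAMP δ snr π ≤ s := by
  obtain ⟨t, ht, hts⟩ := exists_mem_stationaryPoints_le h hδ hsnr hs hle
  exact ((isLeast_sAMP h hδ hsnr).2 ht).trans hts

lemma le_sAMP_mul (h : IsStandardized π) {δ snr : ℝ} (hδ : 0 < δ) (hsnr : 0 < snr) :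
    δ ≤ sAMP δ snr π * (1 + 1 / snr) := by
  obtain ⟨h0, he⟩ := (mem_stationaryPoints_iff h hδ hsnr).1 (isLeast_sAMP h hδ hsnr).1
  calc δ = _ := he.symm
    _ ≤ _ := by gcongr; exact h.mmse_le_one _

lemma eq_ratio_mul {δ snr : ℝ} (hsnr : 0 < snr) (hρ : 0 < δ / deltaAMP snr π) :
    δ = 2 * H π * (δ / deltaAMP snr π) * (1 + 1 / snr) := by
  have hne : deltaAMP snr π ≠ 0 := fun h0 => by simp [h0] at hρ
  have e : deltaAMP snr π = 2 * H π * (1 + 1 / snr) := by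
    rw [deltaAMP]; field_simp; ring
  calc δ = δ / deltaAMP snr π * deltaAMP snr π := (div_mul_cancel₀ _ hne).symm
    _ = δ / deltaAMP snr π * (2 * H π * (1 + 1 / snr)) := by rw [← e]
    _ = _ := by ring

lemma H_nonneg : 0 ≤ H π := ENNReal.toReal_nonneg

/-- If the entropy vanished, so would `deltaAMP`, and the quotient would be `0` by the convention
for division by zero. -/
lemma H_pos_of_ratio_pos {δ snr : ℝ} (hρ : 0 < δ / deltaAMP snr π) : 0 < H π := by
  refine lt_of_le_of_ne H_nonneg fun h0 => ?_
  simp [deltaAMP, ← h0] at hρ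

lemma sAMP_le_of_ratio_le (h : IsStandardized π) {δ snr t : ℝ} (hδ : 0 < δ) (hsnr : 0 < snr)
    (ht : 0 ≤ t) (hρ : 0 < δ / deltaAMP snr π)
    (hle : δ / deltaAMP snr π ≤ t * mmse π (2 * H π * t)) : sAMP δ snr π ≤ 2 * H π * t := by
  have hH := H_pos_of_ratio_pos hρ
  refine sAMP_le h hδ hsnr (by positivity) ?_
  -- This weaker inequality handles the `1 / snr` part of `δ`; the hypothesis handles the rest.
  have h1 : δ / deltaAMP snr π ≤ t :=
    hle.trans (mul_le_of_le_one_right ht (h.mmse_le_one _))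
  calc δ = 2 * H π * (δ / deltaAMP snr π + δ / deltaAMP snr π * (1 / snr)) := by
        conv_lhs => rw [eq_ratio_mul hsnr hρ]
        ring
    _ ≤ 2 * H π * (t * mmse π (2 * H π * t) + t * (1 / snr)) := by gcongr
    _ = _ := by ring

lemma le_sAMP_of_le_ratio (h : IsStandardized π) {δ snr t : ℝ} (hδ : 0 < δ) (hsnr : 0 < snr)
    (hρ : 0 < δ / deltaAMP snr π) (hle : t ≤ δ / deltaAMP snr π) :
    2 * H π * t ≤ sAMP δ snr π := by
  have hH := H_pos_of_ratio_pos hρ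
  have h1 := le_sAMP_mul h hδ hsnr
  have h2 : 2 * H π * (δ / deltaAMP snr π) * (1 + 1 / snr) ≤ sAMP δ snr π * (1 + 1 / snr) :=
    (eq_ratio_mul hsnr hρ).symm.trans_le h1
  refine le_trans ?_ (le_of_mul_le_mul_right h2 (by positivity))
  gcongr

end

end SingleLetter

/-! ### The phase transition -/

theorem theorem2
    (π : ℝ → Measure ℝ) (hπ : SingleLetter.StepAssumption π)
    (r : ℝ) (hr : r ∈ Set.Ioo (0 : ℝ) 1 ∪ Set.Ioi 1)
    (δ snr : ℝ → ℝ) (hδ : ∀ ε, 0 < ε → 0 < δ ε) (hsnr : ∀ ε, 0 < ε → 0 < snr ε)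
    (hlim : Tendsto (fun ε => δ ε / SingleLetter.deltaAMP (snr ε) (π ε)) (𝓝[>] 0) (𝓝 r)) :
    (∀ ε, 0 < ε →
      IsLeast (SingleLetter.stationaryPoints (δ ε) (snr ε) (π ε))
        (SingleLetter.sAMP (δ ε) (snr ε) (π ε))) ∧
    (r ∈ Set.Ioo (0 : ℝ) 1 →
      Tendsto (fun ε => SingleLetter.mmse (π ε) (SingleLetter.sAMP (δ ε) (snr ε) (π ε)))
        (𝓝[>] 0) (𝓝 1)) ∧
    (r ∈ Set.Ioi (1 : ℝ) →
      Tendsto (fun ε => SingleLetter.mmse (π ε) (SingleLetter.sAMP (δ ε) (snr ε) (π ε)))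
        (𝓝[>] 0) (𝓝 0)) := by
  have hst := hπ.standardized
  have hpos : ∀ᶠ ε : ℝ in 𝓝[>] 0, 0 < ε := self_mem_nhdsWithin
  have hr0 : 0 < r := by
    rcases hr with h | h
    · exact h.1
    · exact one_pos.trans h
  have hρ := hlim.eventually (lt_mem_nhds hr0)
  refine ⟨fun ε hε => SingleLetter.isLeast_sAMP (hst ε hε) (hδ ε hε) (hsnr ε hε), ?_, ?_⟩
  · rintro ⟨-, hr1⟩
    obtain ⟨t, hrt, ht1⟩ := exists_between hr1
    have ht0 : 0 ≤ t := (hr0.trans hrt).le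
    have hM := hπ.tendsto_one t ⟨ht0, ht1⟩
    -- Here `t M(2Ht) → t > r`, so the ratio eventually falls below it.
    have hlt := hlim.eventually_lt (hM.const_mul t) (by simpa using hrt)
    refine tendsto_of_tendsto_of_tendsto_of_le_of_le' hM tendsto_const_nhds ?_ ?_
    · filter_upwards [hpos, hρ, hlt] with ε hε hρε hltε
      have := (hst ε hε).isProbabilityMeasure
      exact SingleLetter.antitone_mmse (hst ε hε).integrable_sq
        (SingleLetter.sAMP_le_of_ratio_le (hst ε hε) (hδ ε hε) (hsnr ε hε) ht0 hρε hltε.le)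
    · filter_upwards [hpos] with ε hε
      exact (hst ε hε).mmse_le_one _
  · intro hr1
    obtain ⟨t, ht1, htr⟩ := exists_between (show 1 < r from hr1)
    have hM := hπ.tendsto_zero t ht1
    refine tendsto_of_tendsto_of_tendsto_of_le_of_le' tendsto_const_nhds hM
      (Eventually.of_forall fun ε => SingleLetter.mmse_nonneg _) ?_
    filter_upwards [hpos, hρ, hlim.eventually (lt_mem_nhds htr)] with ε hε hρε hltε
    have := (hst ε hε).isProbabilityMeasure
    exact SingleLetter.antitone_mmse (hst ε hε).integrable_sq
      (SingleLetter.le_sAMP_of_le_ratio (hst ε hε) (hδ ε hε) (hsnr ε hε) hρε hltε.le)
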